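/- Let $(\Omega,\mathcal A,\mu)$ be an arbitrary measure space and $(M,d)$ a complete metric space. *Conventions.* An atom is a set $A\in\mathcal A$ with $\mu(A)>0$ such that every measurable $B\subset A$ has $\mu(B)=0$ or $\mu(B)=\mu(A)$. Let $\mathcal A_{a\sigma}$ be the system of countable unions of atoms and sets of finite measure. A measurability property holds *integrally* if it holds on every $A\in\mathcal A_{a\sigma}$, and a property holds *integrally almost everywhere* (i.a.e.) if, for every $A\in\mathcal A_{a\sigma}$, it holds $\mu$-a.e. on $A$ (for exceptional sets in the $\mu$-completion of $\mathcal A$ this is the same as $\mu$-a.e.). Let $\mathcal S(M)$ be the system of separable subsets of $M$. Strongly measurable functions are the pointwise limits of sequences of measurable functions with finitely many values. For a family $\alpha=(\alpha_A)_{A\in\mathcal A_{a\sigma}}$ of measurable functions $\alpha_A\colon A\to[-\infty,\infty]$ with $\alpha_A=\alpha_B$ a.e. on $A\cap B$, the exhausting integral is $\int\alpha\,d\mu=\int\alpha^+d\mu-\int\alpha^-d\mu$, where $\int\alpha^\pm d\mu=\sup_{A\in\mathcal A_{a\sigma}}\int_A\alpha_A^\pm\,d\mu$, and $\int\alpha\,d\mu=+\infty$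 if both of these are infinite; an integrally measurable function $\alpha$ on $\Omega$ is integrated as the family of its restrictions. All integrals below are meant in this sense. *Hypotheses.* Let $R$ be a set of integrally strongly measurable functions $u\colon\Omega\to M$ that is almost decomposable: for all $u_0\in R$, $F\in\mathcal A$ with $\mu(F)<\infty$, $\varepsilon>0$ and every bounded strongly measurable $u_1\colon F\to M$ there is a measurable $F_\varepsilon\subset F$ with $\mu(F\setminus F_\varepsilon)<\varepsilon$ such that the function equal to $u_1$ on $F_\varepsilon$ and to $u_0$ on $\Omega\setminus F_\varepsilon$ belongs to $R$. Let $f\colon\Omega\times M\to[-\infty,\infty]$ be integrally separably measurable: for all $A\in\mathcal A_{a\sigma}$ and $W\in\mathcal S(M)$ the restriction of $f$ to $A\times W$ is measurable with respect to the product of the trace $\sigma$-algebra of $\mathcal A$ on $A$ and the Borel $\sigma$-algebra of $W$. Suppose that for every atom $A$ with $\mu(A)=\infty$ and every $W\in\mathcal S(M)$ one has $\inf_{x\in W}f(\omega,x)\ge0$ for a.e. $\omega\in A$. Put $I_f(u)=\int f(\omega,u(\omega))\,d\mu(\omega)$ and suppose that $I_f(u)\neq+\infty$ for some $u\in R$.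 *Conclusions.* 1. For every $A\in\mathcal A_{a\sigma}$ the essential infimum function on $A$ $$m_A(\omega)=\operatorname*{ess\,inf}_{W\in\mathcal S(M)}\ \inf_{x\in W}f(\omega,x)$$ exists (the a.e. largest $\mu$-measurable function on $A$ that is, for each $W\in\mathcal S(M)$, a.e. at most $\inf_{x\in W}f(\cdot,x)$), and $$\inf_{u\in R}I_f(u)=\int\operatorname*{ess\,inf}_{W\in\mathcal S(M)}\ \inf_{x\in W}f(\omega,x)\,d\mu(\omega),$$ the right-hand side being the exhausting integral of the family $(m_A)$. 2. Suppose that this common value is not $-\infty$. Then the essential infimum function exists on all of $\Omega$ in the i.a.e. sense: there is a $\mu$-measurable $\bar m\colon\Omega\to[-\infty,\infty]$ such that $\bar m\le\inf_{x\in W}f(\cdot,x)$ i.a.e. for every $W\in\mathcal S(M)$, and every $\mu$-measurable $r$ with the same property satisfies $r\le\bar m$ a.e. For every such $\bar m$: - $\inf_{u\in R}I_f(u)=\int\bar m\,d\mu$; - for every $A\in\mathcal A_{a\sigma}$ there is $W\in\mathcal S(M)$ with $\inf_{x\in W}f(\omega,x)=\bar m(\omega)$ for a.e. $\omega\in A$;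 and if all $u\in R$ have separable range (in particular, if they are strongly measurable), then there is a single $W\in\mathcal S(M)$ with $\inf_{x\in W}f(\omega,x)=\bar m(\omega)$ i.a.e. on $\Omega$; - for $\bar u\in R$, $$\bar u\in\operatorname*{Arg\,min}_{u\in R}I_f(u)\iff f(\omega,\bar u(\omega))=\bar m(\omega)\ \text{ i.a.e.},$$ and "i.a.e." may be replaced by "$\mu$-a.e." if $\omega\mapsto f(\omega,\bar u(\omega))$ is $\mu$-measurable. Here "$\mu$-measurable" means measurable with respect to the $\mu$-completion of $\mathcal A$. -/

import Mathlib

open MeasureTheory Set TopologicalSpace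
open scoped ENNReal

noncomputable section

/-- An atom of `μ`: a measurable set of positive measure, each measurable subset of which has
either measure zero or full measure. (An infinite atom is thus a set of infinite measure all of
whose measurable subsets have measure `0` or `∞`.) -/
def IsMeasureAtom {Ω : Type*} [MeasurableSpace Ω] (μ : Measure Ω) (A : Set Ω) : Prop :=
  MeasurableSet A ∧ 0 < μ A ∧ ∀ B, MeasurableSet B → B ⊆ A → μ B = 0 ∨ μ B = μ A

/-- The `σ`-ring of countable unions of atoms and sets of finite measure, i.e. of sets arising as
the union of a `σ`-finite set and countably many atoms. -/
def IsAtomSigmaFinite {Ω : Type*} [MeasurableSpace Ω] (μ : Measure Ω) (A : Set Ω) : Prop :=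
  ∃ s : ℕ → Set Ω,
    (∀ n, MeasurableSet (s n) ∧ (μ (s n) < ∞ ∨ IsMeasureAtom μ (s n))) ∧ A = ⋃ n, s n

/-- `p` holds integrally almost everywhere: the exceptional set has null intersection with every
atom and with every `σ`-finite set. -/
def IntegrallyAE {Ω : Type*} [MeasurableSpace Ω] (μ : Measure Ω) (p : Ω → Prop) : Prop :=
  ∀ A, IsAtomSigmaFinite μ A → ∀ᵐ ω ∂(μ.restrict A), p ω

/-- A set of the completed `σ`-algebra is null iff it is integrally null. -/
theorem integrallyAE_iff_ae {Ω : Type*} [MeasurableSpace Ω] (μ : Measure Ω) (p : Ω → Prop)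
    (hp : NullMeasurableSet {ω | ¬ p ω} μ) : IntegrallyAE μ p ↔ ∀ᵐ ω ∂μ, p ω := by
  constructor
  · intro h
    obtain ⟨N, hNsub, hN, hNe⟩ := hp.exists_measurable_subset_ae_eq
    have key : ∀ B, MeasurableSet B → B ⊆ N → (μ B < ∞ ∨ IsMeasureAtom μ B) → μ B = 0 := by
      intro B hB hBN hB'
      have h1 := h B ⟨fun _ => B, fun _ => ⟨hB, hB'⟩, (iUnion_const B).symm⟩
      rw [ae_restrict_iff' hB, ae_iff] at h1
      refine measure_mono_null (fun ω hω => ?_) h1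
      intro hc
      exact hNsub (hBN hω) (hc hω)
    rw [ae_iff, ← measure_congr hNe]
    by_contra hpos
    by_cases hat : IsMeasureAtom μ N
    · exact hpos (key N hN subset_rfl (Or.inr hat))
    · unfold IsMeasureAtom at hat
      push Not at hat
      obtain ⟨B, hB, hBN, h0, h1⟩ := hat hN (pos_iff_ne_zero.2 hpos)
      exact h0 (key B hB hBN (Or.inl
        (lt_of_lt_of_le (lt_of_le_of_ne (measure_mono hBN) h1) le_top)))
  · intro h A _
    exact ae_restrict_of_ae h

/-- `u` is strongly measurable on every atom and every `σ`-finite set. -/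
def IntegrallyStronglyMeasurable {Ω M : Type*} [MeasurableSpace Ω] [TopologicalSpace M]
    (μ : Measure Ω) (u : Ω → M) : Prop :=
  ∀ A, IsAtomSigmaFinite μ A → StronglyMeasurable (A.domRestrict u)

/-- For every separable `W ⊆ M` and every `A` that is an atom or a `σ`-finite set, the restriction
of the integrand `f` to `A × W` is measurable for the product of the trace `σ`-algebra on `A` and
the Borel `σ`-algebra of `W`. -/
def IntegrallySeparablyMeasurable {Ω M : Type*} [MeasurableSpace Ω] [TopologicalSpace M]
    [MeasurableSpace M] (μ : Measure Ω) (f : Ω → M → EReal) : Prop :=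
  ∀ A, IsAtomSigmaFinite μ A → ∀ W : Set M, IsSeparable W →
    Measurable (fun p : A × W => f p.1 p.2)

open Classical in
/-- Almost decomposability of a space `R` of functions `Ω → M`. Here `u₁` matters only on `F`. -/
def IsAlmostDecomposable {Ω M : Type*} [MeasurableSpace Ω] [MetricSpace M]
    (μ : Measure Ω) (R : Set (Ω → M)) : Prop :=
  ∀ u₀ ∈ R, ∀ F : Set Ω, MeasurableSet F → μ F < ∞ → ∀ ε : ℝ≥0∞, 0 < ε →
    ∀ u₁ : Ω → M, StronglyMeasurable (F.domRestrict u₁) → Bornology.IsBounded (u₁ '' F) →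
      ∃ Fε : Set Ω, MeasurableSet Fε ∧ Fε ⊆ F ∧ μ (F \ Fε) < ε ∧ Fε.piecewise u₁ u₀ ∈ R

/-- The exhausting integral of a family `α A : A → [-∞, ∞]` indexed by the countable unions `A` of
atoms and finite-measure sets: both the positive and the negative part are integrated as a supremum
over all such `A`, and the integral is `+∞` as soon as that of the positive part is infinite (in
particular if both are). -/
def exhaustingIntegralFamily {Ω : Type*} [MeasurableSpace Ω] (μ : Measure Ω)
    (α : Set Ω → Ω → EReal) : EReal :=
  let P : ℝ≥0∞ := ⨆ (A : Set Ω) (_ : IsAtomSigmaFinite μ A), ∫⁻ ω in A, (α A ω).toENNReal ∂μ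
  let N : ℝ≥0∞ := ⨆ (A : Set Ω) (_ : IsAtomSigmaFinite μ A), ∫⁻ ω in A, (-α A ω).toENNReal ∂μ
  if P = ∞ then ⊤ else (P : EReal) - (N : EReal)

/-- The exhausting integral of a single function. -/
def exhaustingIntegral {Ω : Type*} [MeasurableSpace Ω] (μ : Measure Ω) (α : Ω → EReal) : EReal :=
  exhaustingIntegralFamily μ (fun _ => α)

/-- The integral functional `I_f`. -/
def integralFunctional {Ω M : Type*} [MeasurableSpace Ω] (μ : Measure Ω) (f : Ω → M → EReal)
    (u : Ω → M) : EReal :=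
  exhaustingIntegral μ (fun ω => f ω (u ω))

/-- `m` is, on the set `A`, the essential infimum function of the functions
`ω ↦ inf_{x ∈ W} f ω x`, where `W` runs through the separable subsets of `M`. -/
def IsSepEssInfOn {Ω M : Type*} [MeasurableSpace Ω] [TopologicalSpace M] (μ : Measure Ω)
    (f : Ω → M → EReal) (A : Set Ω) (m : Ω → EReal) : Prop :=
  AEMeasurable m (μ.restrict A) ∧
  (∀ W : Set M, IsSeparable W → ∀ᵐ ω ∂(μ.restrict A), m ω ≤ ⨅ x ∈ W, f ω x) ∧
  ∀ r : Ω → EReal, AEMeasurable r (μ.restrict A) →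
    (∀ W : Set M, IsSeparable W → ∀ᵐ ω ∂(μ.restrict A), r ω ≤ ⨅ x ∈ W, f ω x) →
    ∀ᵐ ω ∂(μ.restrict A), r ω ≤ m ω

/-- `m` is, on all of `Ω` and with exceptional sets that are integrally null, the essential infimum
function of the functions `ω ↦ inf_{x ∈ W} f ω x`, `W ⊆ M` separable. -/
def IsSepEssInf {Ω M : Type*} [MeasurableSpace Ω] [TopologicalSpace M] (μ : Measure Ω)
    (f : Ω → M → EReal) (m : Ω → EReal) : Prop :=
  AEMeasurable m μ ∧
  (∀ W : Set M, IsSeparable W → IntegrallyAE μ (fun ω => m ω ≤ ⨅ x ∈ W, f ω x)) ∧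
  ∀ r : Ω → EReal, AEMeasurable r μ →
    (∀ W : Set M, IsSeparable W → IntegrallyAE μ (fun ω => r ω ≤ ⨅ x ∈ W, f ω x)) →
    ∀ᵐ ω ∂μ, r ω ≤ m ω

end

/-!
The functions `inf_{x ∈ W} f(·, x)`, `W` separable, are directed downwards, even countably so,
because countable unions of separable sets are separable. On a set `S` of
`σ`-finite measure this makes the
essential infimum function an actual infimum over one separable `W`
(`IntegrallySeparablyMeasurable.exists_iInf_le_of_sigmaFinite`). On an infinite atom it is `0`: the
infima are nonnegative there by assumption, while the positive part of `f(·, u₀)` is integrable and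
so vanishes on infinite atoms whenever `I_f(u₀) ≠ ∞`.

The inequality `∫ ess inf ≤ I_f(u)` is monotonicity, since `u` has separable range on each countable
union of atoms and sets of finite measure. For the converse, a measurable `h` slightly above the
essential infimum on `S` admits a strongly measurable `u₁` with `f(ω, u₁(ω)) < h(ω)` a.e. on `S`;
almost decomposability replaces `u₀` by `u₁` on most of `S`, and dominated convergence for the
positive part and Fatou's lemma for the negative part show that little is lost
(`IsAlmostDecomposable.exists_mem_lintegral_le`). The function `h` is a truncation from below of the
essential infimum plus a small positive integrable function.

Both the measurability of the infima for the completion and the existence of `u₁` come from a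
measurable selection theorem (`exists_measurable_selection_ae`), valid up to null sets: a measurable
subset of `Ω × P`, `P` Polish, is the preimage of a Borel subset of `2^ℕ × P`. That set is a
continuous image of the Baire space, the outer measure of its projection is approximated from inside
by images of compact boxes, and over a compact box a section is found by minimizing a continuous
injection into `ℝ` on each fibre.

If the common value is finite, the positive and negative parts of the local essential infimum
functions have finite exhausting integral. They vanish outside a set of `σ`-finite measure
(`IsConsistentFamily.exists_sigmaFinite_carrier`), so a global essential infimum function arises by
extension by zero. Minimizers are characterized by the fact that `α ≤ β` with equal finite integrals
forces `α = β` i.a.e. (`integrallyAE_eq_of_exhaustingIntegral_le`).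
-/

/-! ### Measurable selection -/

/-- The box `∏ᵢ [0, bᵢ]` of the Baire space is compact. -/
theorem isCompact_setOf_forall_le (b : ℕ → ℕ) : IsCompact {x : ℕ → ℕ | ∀ i, x i ≤ b i} := by
  have : {x : ℕ → ℕ | ∀ i, x i ≤ b i} = Set.pi univ (fun i => Iic (b i)) := by
    ext x
    simp [Pi.le_def]
  rw [this]
  exact isCompact_univ_pi fun i => (finite_Iic (b i)).isCompact

/-- A neighbourhood of the compact box `∏ᵢ [0, bᵢ]` of the Baire space contains a cylinder
`∏_{i < n} [0, bᵢ] × ∏_{i ≥ n} ℕ`. -/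
theorem exists_cylinder_subset_of_isOpen {b : ℕ → ℕ} {U : Set (ℕ → ℕ)} (hU : IsOpen U)
    (hb : {x : ℕ → ℕ | ∀ i, x i ≤ b i} ⊆ U) :
    ∃ n, {x : ℕ → ℕ | ∀ i < n, x i ≤ b i} ⊆ U := by
  by_contra! hcon
  have hcon' : ∀ n, ∃ x : ℕ → ℕ, (∀ i < n, x i ≤ b i) ∧ x ∉ U := fun n => by
    obtain ⟨x, hx, hxU⟩ := not_subset.1 (hcon n)
    exact ⟨x, hx, hxU⟩
  choose x hx hxU using hcon'
  have hK := isCompact_setOf_forall_le b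
  -- truncating `x n` by `b` leads into the box without changing the first `n` coordinates
  obtain ⟨a, ha, φ, hφ, hlim⟩ := hK.tendsto_subseq (x := fun n i => min (x n i) (b i))
    (fun n i => min_le_right _ _)
  have hlim' : Filter.Tendsto (fun n => x (φ n)) Filter.atTop (nhds a) := by
    rw [tendsto_pi_nhds] at hlim ⊢
    intro i
    refine (hlim i).congr' ?_
    filter_upwards [Filter.eventually_gt_atTop i] with n hn
    exact min_eq_left (hx (φ n) i (lt_of_lt_of_le hn (hφ.id_le n)))
  exact hU.isClosed_compl.mem_of_tendsto hlim' (Filter.Eventually.of_forall fun n => hxU (φ n))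
    (hb ha)

/-- Inner approximation of the outer measure of an analytic set by continuous images of compact
boxes of the Baire space. -/
theorem exists_measure_range_le_image_box {Y : Type*} [TopologicalSpace Y] [MeasurableSpace Y]
    (ν : Measure Y) [IsFiniteMeasure ν] [ν.OuterRegular] {ψ : (ℕ → ℕ) → Y}
    (hψ : Continuous ψ) {ε : ℝ≥0∞} (hε : ε ≠ 0) :
    ∃ b : ℕ → ℕ, ν (range ψ) ≤ ν (ψ '' {x | ∀ i, x i ≤ b i}) + ε := by
  obtain ⟨δ, hδ, hδs⟩ := ENNReal.exists_pos_sum_of_countable' hε ℕ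
  -- bound one coordinate more, at the price of `δ n`
  have step : ∀ (n : ℕ) (b : ℕ → ℕ), ∃ k : ℕ,
      ν (ψ '' {x | ∀ i < n, x i ≤ b i}) ≤
        ν (ψ '' {x | (∀ i < n, x i ≤ b i) ∧ x n ≤ k}) + δ n := by
    intro n b
    have hU : ψ '' {x | ∀ i < n, x i ≤ b i} =
        ⋃ k : ℕ, ψ '' {x | (∀ i < n, x i ≤ b i) ∧ x n ≤ k} := by
      rw [← image_iUnion]
      congr 1
      ext x
      simp only [mem_ofPred_eq, mem_iUnion, exists_and_left]
      exact ⟨fun h => ⟨h, x n, le_rfl⟩, fun h => h.1⟩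
    have hmono : Monotone fun k : ℕ => ψ '' {x | (∀ i < n, x i ≤ b i) ∧ x n ≤ k} :=
      fun k l hkl => image_mono fun x hx => ⟨hx.1, hx.2.trans hkl⟩
    by_cases h0 : ν (ψ '' {x | ∀ i < n, x i ≤ b i}) = 0
    · exact ⟨0, by rw [h0]; exact zero_le⟩
    have hlt : ν (ψ '' {x | ∀ i < n, x i ≤ b i}) - δ n <
        ⨆ k : ℕ, ν (ψ '' {x | (∀ i < n, x i ≤ b i) ∧ x n ≤ k}) := by
      rw [← hmono.measure_iUnion, ← hU]
      exact ENNReal.sub_lt_self (measure_ne_top _ _) h0 (hδ n).ne'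
    obtain ⟨k, hk⟩ := lt_iSup_iff.1 hlt
    exact ⟨k, tsub_le_iff_right.1 hk.le⟩
  choose k hk using step
  let seq : ℕ → (ℕ → ℕ) := fun n =>
    Nat.rec (fun _ => 0) (fun n b => Function.update b n (k n b)) n
  have seq_succ : ∀ n, seq (n + 1) = Function.update (seq n) n (k n (seq n)) := fun n => rfl
  let b : ℕ → ℕ := fun n => k n (seq n)
  have hseq : ∀ n, ∀ i < n, seq n i = b i := by
    intro n
    induction n with
    | zero => intro i hi; omega
    | succ n ih =>
      intro i hi
      rw [seq_succ]
      rcases Nat.lt_succ_iff_lt_or_eq.1 hi with h | h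
      · rw [Function.update_of_ne h.ne, ih i h]
      · subst h
        rw [Function.update_self]
  have hcyl : ∀ n, {x : ℕ → ℕ | ∀ i < n, x i ≤ seq n i} = {x | ∀ i < n, x i ≤ b i} := by
    intro n
    ext x
    exact forall₂_congr fun i hi => by rw [hseq n i hi]
  have main : ∀ n, ν (range ψ) ≤
      ν (ψ '' {x | ∀ i < n, x i ≤ b i}) + ∑ i ∈ Finset.range n, δ i := by
    intro n
    induction n with
    | zero => simp
    | succ n ih =>
      refine ih.trans ?_
      have h1 := hk n (seq n)
      rw [hcyl n] at h1
      have h2 : {x : ℕ → ℕ | (∀ i < n, x i ≤ seq n i) ∧ x n ≤ k n (seq n)} =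
          {x | ∀ i < n + 1, x i ≤ b i} := by
        ext x
        simp only [mem_ofPred_eq, Nat.forall_lt_succ_right]
        refine and_congr ?_ Iff.rfl
        exact forall₂_congr fun i hi => by rw [hseq n i hi]
      rw [h2] at h1
      rw [Finset.sum_range_succ, add_comm (∑ i ∈ Finset.range n, δ i), ← add_assoc]
      gcongr
  refine ⟨b, ?_⟩
  have hopen : ∀ V, ψ '' {x | ∀ i, x i ≤ b i} ⊆ V → IsOpen V → ν (range ψ) ≤ ν V + ε := by
    intro V hKV hV
    obtain ⟨n, hn⟩ := exists_cylinder_subset_of_isOpen (hV.preimage hψ) (image_subset_iff.1 hKV)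
    refine (main n).trans (add_le_add (measure_mono (image_subset_iff.2 hn)) ?_)
    exact (ENNReal.sum_le_tsum _).trans hδs.le
  rw [Set.measure_eq_iInf_isOpen (ψ '' {x | ∀ i, x i ≤ b i})]
  simp only [ENNReal.iInf_add]
  exact le_iInf fun V => le_iInf fun h1 => le_iInf fun h2 => hopen V h1 h2

theorem exists_continuous_injective_baire_real :
    ∃ e : (ℕ → ℕ) → ℝ, Continuous e ∧ Function.Injective e := by
  let c : (ℕ → ℕ) → (ℕ → Bool) := fun x n => decide (x n.unpair.1 = n.unpair.2)
  have hc : Continuous c := continuous_pi fun n =>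
    (continuous_of_discreteTopology (f := fun k : ℕ => decide (k = n.unpair.2))).comp
      (continuous_apply n.unpair.1)
  have hci : Function.Injective c := by
    intro x y hxy
    ext i
    have := congrFun hxy (Nat.pair i (y i))
    simpa [c] using this
  have hd : Continuous (Cardinal.cantorFunction (1 / 3)) := by
    refine continuous_tsum (u := fun n => (1 / 3 : ℝ) ^ n) (fun n => ?_)
      (summable_geometric_of_lt_one (by norm_num) (by norm_num)) (fun n f => ?_)
    · exact (continuous_of_discreteTopology
        (f := fun t : Bool => cond t ((1 / 3 : ℝ) ^ n) 0)).comp (continuous_apply n)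
    · unfold Cardinal.cantorFunctionAux
      cases f n <;> simp
  exact ⟨_, hd.comp hc,
    (Cardinal.cantorFunction_injective (by norm_num) (by norm_num)).comp hci⟩

/-- A continuous map on the Baire space has a measurable right inverse over the image of a compact
set: choose in each fibre the point where a continuous injection into `ℝ` is minimal. -/
theorem exists_measurable_section_of_isCompact {Y : Type*} [TopologicalSpace Y] [T2Space Y]
    [MeasurableSpace Y] [OpensMeasurableSpace Y] {ψ : (ℕ → ℕ) → Y} (hψ : Continuous ψ)
    {K : Set (ℕ → ℕ)} (hK : IsCompact K) :
    ∃ σ : Y → (ℕ → ℕ), Measurable σ ∧ ∀ y ∈ ψ '' K, ψ (σ y) = y := by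
  classical
  obtain ⟨e, he, hei⟩ := exists_continuous_injective_baire_real
  have hmin : ∀ y ∈ ψ '' K, ∃ x ∈ K, ψ x = y ∧ ∀ z ∈ K, ψ z = y → e x ≤ e z := by
    rintro y ⟨x₀, hx₀, rfl⟩
    have hc : IsCompact (K ∩ ψ ⁻¹' {ψ x₀}) := hK.inter_right (isClosed_singleton.preimage hψ)
    obtain ⟨x, hx, hxm⟩ := hc.exists_isMinOn ⟨x₀, hx₀, rfl⟩ he.continuousOn
    exact ⟨x, hx.1, hx.2, fun z hz hzy => hxm ⟨hz, hzy⟩⟩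
  choose! s hsK hsψ hsm using hmin
  have hKm : MeasurableSet (ψ '' K) := (hK.image hψ).measurableSet
  have hemb : MeasurableEmbedding e := he.measurableEmbedding hei
  let σ : Y → (ℕ → ℕ) := fun y => if y ∈ ψ '' K then s y else fun _ => 0
  have hσ : Measurable σ := by
    rw [← hemb.measurable_comp_iff]
    have : e ∘ σ = fun y => if y ∈ ψ '' K then e (s y) else e fun _ => 0 := by
      ext y
      simp only [Function.comp_apply, σ]
      split_ifs <;> rfl
    rw [this]
    refine measurable_of_Iic fun t => ?_
    have hset : (fun y => if y ∈ ψ '' K then e (s y) else e fun _ => 0) ⁻¹' Iic t =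
        ψ '' (K ∩ e ⁻¹' Iic t) ∪ ((ψ '' K)ᶜ ∩ {_y | e (fun _ => 0) ≤ t}) := by
      ext y
      by_cases hy : y ∈ ψ '' K
      · simp only [mem_preimage, hy, if_true, mem_Iic, mem_union, mem_inter_iff, mem_compl_iff,
          not_true_eq_false, false_and, or_false]
        constructor
        · exact fun h => ⟨s y, ⟨hsK y hy, h⟩, hsψ y hy⟩
        · rintro ⟨z, ⟨hzK, hzt⟩, hz⟩
          exact (hsm y hy z hzK hz).trans hzt
      · have hy' : y ∉ ψ '' (K ∩ e ⁻¹' Iic t) := fun h => hy (image_mono inter_subset_left h)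
        simp only [mem_preimage, hy, if_false, mem_Iic, mem_union, hy', false_or, mem_inter_iff,
          mem_compl_iff, not_false_eq_true, true_and, mem_ofPred_eq]
    rw [hset]
    exact ((hK.inter_right (isClosed_Iic.preimage he)).image hψ).measurableSet.union
      (hKm.compl.inter (MeasurableSet.const _))
  exact ⟨σ, hσ, fun y hy => by simp only [σ, hy, if_true]; exact hsψ y hy⟩

/-- A set in a product `σ`-algebra depends on the first coordinate only through countably many
measurable sets, that is, through a measurable map into the Cantor space. -/
theorem exists_measurable_cantor_preimage {Ω P : Type*} [MeasurableSpace Ω] [MeasurableSpace P]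
    {G : Set (Ω × P)} (hG : MeasurableSet G) :
    ∃ (φ : Ω → ℕ → Bool) (G₀ : Set ((ℕ → Bool) × P)), Measurable φ ∧ MeasurableSet G₀ ∧
      G = Prod.map φ id ⁻¹' G₀ := by
  classical
  induction G, hG using
    MeasurableSpace.induction_on_inter generateFrom_prod.symm isPiSystem_prod with
  | empty => exact ⟨fun _ _ => true, ∅, measurable_const, .empty, rfl⟩
  | basic t ht =>
    obtain ⟨A, hA, C, hC, rfl⟩ := ht
    refine ⟨fun ω _ => decide (ω ∈ A), {y | y 0 = true} ×ˢ C, ?_, ?_, ?_⟩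
    · refine measurable_pi_lambda _ fun _ => measurable_to_bool ?_
      have : (fun ω => decide (ω ∈ A)) ⁻¹' {true} = A := by ext; simp
      rw [this]; exact hA
    · exact (measurableSet_eq_fun (measurable_pi_apply 0) measurable_const).prod hC
    · ext ⟨ω, x⟩; simp
  | compl t ht ih =>
    obtain ⟨φ, G₀, hφ, hG₀, rfl⟩ := ih
    exact ⟨φ, G₀ᶜ, hφ, hG₀.compl, rfl⟩
  | iUnion s hd hs ih =>
    choose φ G₀ hφ hG₀ hs' using ih
    let p : ℕ → (ℕ → Bool) → (ℕ → Bool) := fun n y k => y (Nat.pair n k)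
    have hp : ∀ n, Measurable (p n) := fun n =>
      measurable_pi_lambda _ fun k => measurable_pi_apply _
    refine ⟨fun ω k => φ k.unpair.1 ω k.unpair.2, ⋃ n, Prod.map (p n) id ⁻¹' G₀ n, ?_, ?_, ?_⟩
    · exact measurable_pi_lambda _ fun k => (measurable_pi_apply _).comp (hφ _)
    · exact .iUnion fun n => ((hp n).prodMap measurable_id) (hG₀ n)
    · rw [preimage_iUnion]
      refine iUnion_congr fun n => ?_
      rw [hs' n]
      ext ⟨ω, x⟩
      simp [p]

/-- Measurable selection over all of a projection except for a set of outer measure at most `ε`. -/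
theorem exists_measurable_selection_approx {Ω P : Type*} [MeasurableSpace Ω] [TopologicalSpace P]
    [PolishSpace P] [Nonempty P] [MeasurableSpace P] [BorelSpace P] (μ : Measure Ω)
    [IsFiniteMeasure μ] {G : Set (Ω × P)} (hG : MeasurableSet G) {ε : ℝ≥0∞} (hε : ε ≠ 0) :
    ∃ (B : Set Ω) (u : Ω → P), MeasurableSet B ∧ Measurable u ∧ (∀ ω ∈ B, (ω, u ω) ∈ G) ∧
      μ (Prod.fst '' G) ≤ μ B + ε := by
  obtain ⟨φ, G₀, hφ, hG₀, rfl⟩ := exists_measurable_cantor_preimage hG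
  -- instance search for `ℕ → Bool` needs this one spelled out
  have : PolishSpace Bool := inferInstance
  have han : AnalyticSet G₀ := hG₀.analyticSet
  rw [AnalyticSet] at han
  rcases han with rfl | ⟨ψ, hψ, rfl⟩
  · exact ⟨∅, fun _ => Classical.arbitrary P, .empty, measurable_const, by simp, by simp⟩
  have hψ1 : Continuous fun x => (ψ x).1 := continuous_fst.comp hψ
  obtain ⟨b, hb⟩ := exists_measure_range_le_image_box (μ.map φ) hψ1 hε
  have hK := isCompact_setOf_forall_le b
  obtain ⟨σ, hσ, hσψ⟩ := exists_measurable_section_of_isCompact hψ1 hK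
  have hKm : MeasurableSet ((fun x => (ψ x).1) '' {x : ℕ → ℕ | ∀ i, x i ≤ b i}) :=
    (hK.image hψ1).measurableSet
  refine ⟨φ ⁻¹' ((fun x => (ψ x).1) '' {x | ∀ i, x i ≤ b i}), fun ω => (ψ (σ (φ ω))).2,
    hφ hKm, measurable_snd.comp (hψ.measurable.comp (hσ.comp hφ)), fun ω hω => ?_, ?_⟩
  · exact ⟨σ (φ ω), Prod.ext (hσψ _ hω) rfl⟩
  · calc μ (Prod.fst '' (Prod.map φ id ⁻¹' range ψ))
        ≤ μ (φ ⁻¹' range fun x => (ψ x).1) := by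
          refine measure_mono ?_
          rintro _ ⟨⟨ω, x⟩, ⟨z, hz⟩, rfl⟩
          exact ⟨z, by simp [hz]⟩
      _ ≤ μ.map φ (range fun x => (ψ x).1) := Measure.le_map_apply hφ.aemeasurable _
      _ ≤ _ := hb
      _ = _ := by rw [Measure.map_apply hφ hKm]

/-- Measurable selection and projection: a measurable set in the product of a `σ`-finite measure
space and a Polish space has, up to a null set, a measurable projection and a measurable
uniformization. -/
theorem exists_measurable_selection_ae {Ω P : Type*} [MeasurableSpace Ω] [TopologicalSpace P]
    [PolishSpace P] [Nonempty P] [MeasurableSpace P] [BorelSpace P] (μ : Measure Ω)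
    [SigmaFinite μ] {G : Set (Ω × P)} (hG : MeasurableSet G) :
    ∃ (B : Set Ω) (u : Ω → P), MeasurableSet B ∧ Measurable u ∧ (∀ ω ∈ B, (ω, u ω) ∈ G) ∧
      μ (Prod.fst '' G \ B) = 0 := by
  classical
  have hsel := fun n : ℕ => exists_measurable_selection_approx μ.toFinite hG
    (ε := ((n : ℝ≥0∞) + 1)⁻¹) (by simp)
  choose B u hB hu hG' hμ using hsel
  have hBU : MeasurableSet (⋃ n, B n) := .iUnion hB
  have hex : ∀ ω, ∃ n, ω ∈ B n ∨ ω ∉ ⋃ n, B n := by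
    intro ω
    by_cases h : ω ∈ ⋃ n, B n
    · obtain ⟨n, hn⟩ := mem_iUnion.1 h
      exact ⟨n, .inl hn⟩
    · exact ⟨0, .inr h⟩
  refine ⟨⋃ n, B n, fun ω => u (Nat.find (hex ω)) ω, hBU, ?_, ?_, ?_⟩
  · exact Measurable.find (p := fun n ω => ω ∈ B n ∨ ω ∉ ⋃ n, B n) hu
      (fun n => (hB n).union hBU.compl) hex
  · intro ω hω
    exact hG' _ _ ((Nat.find_spec (hex ω)).resolve_right (not_not.2 hω))
  · rw [← toFinite_apply_eq_zero_iff]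
    have hsub : (⋃ n, B n) ⊆ Prod.fst '' G :=
      iUnion_subset fun n ω hω => ⟨_, hG' n ω hω, rfl⟩
    have hle : μ.toFinite (Prod.fst '' G) ≤ μ.toFinite (⋃ n, B n) := by
      refine ENNReal.le_of_forall_pos_le_add fun ε hε _ => ?_
      obtain ⟨n, hn⟩ := ENNReal.exists_inv_nat_lt (a := ε) (by positivity)
      refine (hμ n).trans (add_le_add (measure_mono (subset_iUnion B n)) ?_)
      refine le_trans ?_ hn.le
      exact ENNReal.inv_le_inv.2 le_self_add
    have h := measure_sdiff_add_inter (μ := μ.toFinite) (Prod.fst '' G) hBU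
    rw [inter_eq_self_of_subset_right hsub] at h
    by_contra hne
    have : μ.toFinite (⋃ n, B n) < μ.toFinite (Prod.fst '' G) := by
      rw [← h, add_comm]
      exact ENNReal.lt_add_right (measure_ne_top _ _) hne
    exact absurd hle this.not_ge

theorem nullMeasurableSet_image_fst {Ω P : Type*} [MeasurableSpace Ω] [TopologicalSpace P]
    [PolishSpace P] [MeasurableSpace P] [BorelSpace P] (μ : Measure Ω)
    [SigmaFinite μ] {G : Set (Ω × P)} (hG : MeasurableSet G) :
    NullMeasurableSet (Prod.fst '' G) μ := by
  rcases isEmpty_or_nonempty P with hP | hP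
  · rw [Set.eq_empty_of_isEmpty G, image_empty]
    exact .empty
  obtain ⟨B, u, hB, -, hBG, h0⟩ := exists_measurable_selection_ae μ hG
  have hsub : B ⊆ Prod.fst '' G := fun ω hω => ⟨_, hBG ω hω, rfl⟩
  rw [← union_sdiff_cancel hsub]
  exact hB.nullMeasurableSet.union (.of_null h0)

/-! ### Sets of `σ`-finite measure, atoms and their countable unions -/

/-- `S` is a countable union of measurable sets of finite measure. -/
def IsSigmaFiniteSet {Ω : Type*} [MeasurableSpace Ω] (μ : Measure Ω) (S : Set Ω) : Prop :=
  ∃ s : ℕ → Set Ω, (∀ n, MeasurableSet (s n) ∧ μ (s n) < ∞) ∧ S = ⋃ n, s n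

section Sets

variable {Ω : Type*} [MeasurableSpace Ω] {μ : Measure Ω}

theorem IsSigmaFiniteSet.measurableSet {S : Set Ω} (hS : IsSigmaFiniteSet μ S) :
    MeasurableSet S := by
  obtain ⟨s, hs, rfl⟩ := hS
  exact .iUnion fun n => (hs n).1

theorem IsSigmaFiniteSet.isAtomSigmaFinite {S : Set Ω} (hS : IsSigmaFiniteSet μ S) :
    IsAtomSigmaFinite μ S := by
  obtain ⟨s, hs, rfl⟩ := hS
  exact ⟨s, fun n => ⟨(hs n).1, .inl (hs n).2⟩, rfl⟩

theorem IsSigmaFiniteSet.union {S T : Set Ω} (hS : IsSigmaFiniteSet μ S)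
    (hT : IsSigmaFiniteSet μ T) : IsSigmaFiniteSet μ (S ∪ T) := by
  obtain ⟨s, hs, rfl⟩ := hS
  obtain ⟨t, ht, rfl⟩ := hT
  refine ⟨fun n => s n ∪ t n, fun n => ⟨(hs n).1.union (ht n).1, ?_⟩, ?_⟩
  · exact (measure_union_le _ _).trans_lt (ENNReal.add_lt_top.2 ⟨(hs n).2, (ht n).2⟩)
  · rw [iUnion_union_distrib]

theorem IsSigmaFiniteSet.sigmaFinite_restrict {S : Set Ω} (hS : IsSigmaFiniteSet μ S) :
    SigmaFinite (μ.restrict S) := by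
  have hSm := hS.measurableSet
  obtain ⟨s, hs, hSs⟩ := hS
  refine ⟨⟨⟨fun n => s n ∪ Sᶜ, fun n => trivial, fun n => ?_, ?_⟩⟩⟩
  · rw [Measure.restrict_apply ((hs n).1.union hSm.compl), union_inter_distrib_right,
      compl_inter_self, union_empty]
    exact (measure_mono inter_subset_left).trans_lt (hs n).2
  · rw [← iUnion_union, ← hSs, union_compl_self]

theorem IsAtomSigmaFinite.measurableSet {A : Set Ω} (hA : IsAtomSigmaFinite μ A) :
    MeasurableSet A := by
  obtain ⟨s, hs, rfl⟩ := hA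
  exact .iUnion fun n => (hs n).1

theorem IsAtomSigmaFinite.iUnion {A : ℕ → Set Ω} (hA : ∀ n, IsAtomSigmaFinite μ (A n)) :
    IsAtomSigmaFinite μ (⋃ n, A n) := by
  choose s hs hAs using hA
  refine ⟨fun k => s k.unpair.1 k.unpair.2, fun k => hs _ _, ?_⟩
  rw [Set.iUnion_unpair fun i j => s i j]
  exact iUnion_congr hAs

theorem IsAtomSigmaFinite.union {A B : Set Ω} (hA : IsAtomSigmaFinite μ A)
    (hB : IsAtomSigmaFinite μ B) : IsAtomSigmaFinite μ (A ∪ B) := by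
  have : A ∪ B = ⋃ n : ℕ, if n = 0 then A else B := by
    ext ω
    simp only [mem_union, mem_iUnion]
    constructor
    · rintro (h | h)
      · exact ⟨0, by simpa using h⟩
      · exact ⟨1, by simpa using h⟩
    · rintro ⟨n, hn⟩
      split_ifs at hn
      · exact .inl hn
      · exact .inr hn
  rw [this]
  refine .iUnion fun n => ?_
  split_ifs
  · exact hA
  · exact hB

theorem IsMeasureAtom.isAtomSigmaFinite {A : Set Ω} (hA : IsMeasureAtom μ A) :
    IsAtomSigmaFinite μ A :=
  ⟨fun _ => A, fun _ => ⟨hA.1, .inr hA⟩, (iUnion_const A).symm⟩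

theorem isAtomSigmaFinite_empty : IsAtomSigmaFinite μ (∅ : Set Ω) :=
  ⟨fun _ => ∅, fun _ => ⟨.empty, .inl (by simp)⟩, by simp⟩

/-- Outside a `σ`-finite set, a countable union of atoms and sets of finite measure is covered by
countably many infinite atoms. -/
theorem IsAtomSigmaFinite.exists_sigmaFinite_part {A : Set Ω} (hA : IsAtomSigmaFinite μ A) :
    ∃ S ⊆ A, IsSigmaFiniteSet μ S ∧ ∀ p : Ω → Prop,
      (∀ T ⊆ A, IsMeasureAtom μ T → μ T = ∞ → ∀ᵐ ω ∂μ.restrict T, p ω) →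
        ∀ᵐ ω ∂μ.restrict (A \ S), p ω := by
  classical
  obtain ⟨s, hs, rfl⟩ := hA
  refine ⟨⋃ n, if μ (s n) < ∞ then s n else ∅, ?_,
    ⟨fun n => if μ (s n) < ∞ then s n else ∅, fun n => ?_, rfl⟩, fun p hp => ?_⟩
  · refine iUnion_mono fun n => ?_
    split_ifs
    · exact subset_rfl
    · exact empty_subset _
  · beta_reduce
    split_ifs with h
    · exact ⟨(hs n).1, h⟩
    · exact ⟨.empty, by simp⟩
  · have hcov : (⋃ n, s n) \ (⋃ n, if μ (s n) < ∞ then s n else ∅) ⊆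
        ⋃ n, if μ (s n) < ∞ then ∅ else s n := by
      rintro ω ⟨hω, hω'⟩
      obtain ⟨n, hn⟩ := mem_iUnion.1 hω
      refine mem_iUnion.2 ⟨n, ?_⟩
      split_ifs with h
      · exact hω' (mem_iUnion.2 ⟨n, by simpa [h] using hn⟩)
      · exact hn
    refine ae_restrict_of_ae_restrict_of_subset hcov ((ae_restrict_iUnion_iff _ _).2 fun n => ?_)
    split_ifs with h
    · simp
    · exact hp _ (subset_iUnion s n) ((hs n).2.resolve_left h) (not_lt_top_iff.1 h)

/-- An integrable function vanishes on infinite atoms. -/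
theorem IsMeasureAtom.ae_eq_zero_of_lintegral_ne_top {T : Set Ω} (hT : IsMeasureAtom μ T)
    (hTi : μ T = ∞) {g : Ω → ℝ≥0∞} (hg : AEMeasurable g (μ.restrict T))
    (hgi : ∫⁻ ω in T, g ω ∂μ ≠ ∞) : ∀ᵐ ω ∂μ.restrict T, g ω = 0 := by
  have key : ∀ n : ℕ, ∀ᵐ ω ∂μ.restrict T, ¬ ((n : ℝ≥0∞) + 1)⁻¹ ≤ hg.mk g ω := by
    intro n
    have hm : MeasurableSet {ω | ((n : ℝ≥0∞) + 1)⁻¹ ≤ hg.mk g ω} :=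
      measurableSet_le measurable_const hg.measurable_mk
    have hlt : μ.restrict T {ω | ((n : ℝ≥0∞) + 1)⁻¹ ≤ hg.mk g ω} < ∞ := by
      refine (meas_ge_le_lintegral_div hg.measurable_mk.aemeasurable (by simp) (by simp)).trans_lt
        (ENNReal.div_lt_top ?_ (by simp))
      rwa [← lintegral_congr_ae hg.ae_eq_mk]
    rw [ae_iff]
    simp only [not_not]
    rw [Measure.restrict_apply hm] at hlt ⊢
    refine (hT.2.2 _ (hm.inter hT.1) inter_subset_right).resolve_right ?_
    rw [hTi]
    exact hlt.ne
  filter_upwards [ae_all_iff.2 key, hg.ae_eq_mk] with ω hω hωg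
  rw [hωg]
  by_contra hne
  obtain ⟨n, hn⟩ := ENNReal.exists_inv_nat_lt hne
  exact hω n ((ENNReal.inv_le_inv.2 le_self_add).trans hn.le)

end Sets

/-! ### The exhausting integral -/

/-- The exhausting integral of a family of `[0, ∞]`-valued functions, indexed by the countable
unions of atoms and sets of finite measure. -/
noncomputable def exhaustingLIntegral {Ω : Type*} [MeasurableSpace Ω] (μ : Measure Ω)
    (g : Set Ω → Ω → ℝ≥0∞) : ℝ≥0∞ :=
  ⨆ (A : Set Ω) (_ : IsAtomSigmaFinite μ A), ∫⁻ ω in A, g A ω ∂μ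

/-- The members of the family `g` agree a.e. on common parts of their domains. -/
def IsConsistentFamily {Ω β : Type*} [MeasurableSpace Ω] (μ : Measure Ω) (g : Set Ω → Ω → β) :
    Prop :=
  ∀ A B, IsAtomSigmaFinite μ A → IsAtomSigmaFinite μ B → A ⊆ B → ∀ᵐ ω ∂μ.restrict A, g A ω = g B ω

section Exhausting

variable {Ω : Type*} [MeasurableSpace Ω] {μ : Measure Ω}

theorem exhaustingIntegralFamily_eq (α : Set Ω → Ω → EReal) :
    exhaustingIntegralFamily μ α =
      if exhaustingLIntegral μ (fun A ω => (α A ω).toENNReal) = ∞ then ⊤ else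
        (exhaustingLIntegral μ (fun A ω => (α A ω).toENNReal) : EReal) -
          (exhaustingLIntegral μ (fun A ω => (-α A ω).toENNReal) : EReal) :=
  rfl

theorem IsConsistentFamily.comp {β γ : Type*} {g : Set Ω → Ω → β} (hg : IsConsistentFamily μ g)
    (φ : β → γ) : IsConsistentFamily μ fun A ω => φ (g A ω) := fun A B hA hB hAB => by
  filter_upwards [hg A B hA hB hAB] with ω hω
  rw [hω]

theorem isConsistentFamily_const {β : Type*} (g : Ω → β) :
    IsConsistentFamily μ fun _ => g :=
  fun _ _ _ _ _ => Filter.Eventually.of_forall fun _ => rfl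

theorem le_exhaustingLIntegral (g : Set Ω → Ω → ℝ≥0∞) {A : Set Ω} (hA : IsAtomSigmaFinite μ A) :
    ∫⁻ ω in A, g A ω ∂μ ≤ exhaustingLIntegral μ g :=
  le_iSup₂ (f := fun A (_ : IsAtomSigmaFinite μ A) => ∫⁻ ω in A, g A ω ∂μ) A hA

theorem exhaustingLIntegral_mono {g g' : Set Ω → Ω → ℝ≥0∞}
    (h : ∀ A, IsAtomSigmaFinite μ A → ∀ᵐ ω ∂μ.restrict A, g A ω ≤ g' A ω) :
    exhaustingLIntegral μ g ≤ exhaustingLIntegral μ g' :=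
  iSup₂_mono fun A hA => lintegral_mono_ae (h A hA)

theorem exhaustingIntegralFamily_mono {α β : Set Ω → Ω → EReal}
    (h : ∀ A, IsAtomSigmaFinite μ A → ∀ᵐ ω ∂μ.restrict A, α A ω ≤ β A ω) :
    exhaustingIntegralFamily μ α ≤ exhaustingIntegralFamily μ β := by
  have hP : exhaustingLIntegral μ (fun A ω => (α A ω).toENNReal) ≤
      exhaustingLIntegral μ (fun A ω => (β A ω).toENNReal) :=
    exhaustingLIntegral_mono fun A hA => (h A hA).mono fun ω hω => EReal.toENNReal_le_toENNReal hω
  have hN : exhaustingLIntegral μ (fun A ω => (-β A ω).toENNReal) ≤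
      exhaustingLIntegral μ (fun A ω => (-α A ω).toENNReal) :=
    exhaustingLIntegral_mono fun A hA => (h A hA).mono fun ω hω =>
      EReal.toENNReal_le_toENNReal (EReal.neg_le_neg_iff.2 hω)
  rw [exhaustingIntegralFamily_eq, exhaustingIntegralFamily_eq]
  by_cases h1 : exhaustingLIntegral μ (fun A ω => (β A ω).toENNReal) = ∞
  · rw [if_pos h1]
    exact le_top
  · rw [if_neg h1, if_neg (ne_top_of_le_ne_top h1 hP)]
    exact EReal.sub_le_sub (by exact_mod_cast hP) (by exact_mod_cast hN)

theorem exhaustingLIntegral_ne_top_of_ne_top {α : Set Ω → Ω → EReal}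
    (h : exhaustingIntegralFamily μ α ≠ ⊤) :
    exhaustingLIntegral μ (fun A ω => (α A ω).toENNReal) ≠ ∞ := fun h' =>
  h (by rw [exhaustingIntegralFamily_eq, if_pos h'])

/-- The supremum defining the exhausting integral of a consistent family is attained. -/
theorem IsConsistentFamily.exists_lintegral_eq {g : Set Ω → Ω → ℝ≥0∞}
    (hg : IsConsistentFamily μ g) :
    ∃ A₀, IsAtomSigmaFinite μ A₀ ∧ ∀ A, IsAtomSigmaFinite μ A → A₀ ⊆ A →
      ∫⁻ ω in A, g A ω ∂μ = exhaustingLIntegral μ g := by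
  have hmono : ∀ A B, IsAtomSigmaFinite μ A → IsAtomSigmaFinite μ B → A ⊆ B →
      ∫⁻ ω in A, g A ω ∂μ ≤ ∫⁻ ω in B, g B ω ∂μ := fun A B hA hB hAB => by
    rw [lintegral_congr_ae (hg A B hA hB hAB)]
    exact lintegral_mono_set hAB
  obtain ⟨v, -, hv, hvm⟩ := exists_seq_tendsto_sSup
    (S := {t | ∃ A, IsAtomSigmaFinite μ A ∧ ∫⁻ ω in A, g A ω ∂μ = t})
    ⟨_, ∅, isAtomSigmaFinite_empty, rfl⟩ (OrderTop.bddAbove _)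
  choose A hA hAv using hvm
  refine ⟨⋃ n, A n, .iUnion hA, fun B hB hAB => le_antisymm (le_exhaustingLIntegral g hB) ?_⟩
  refine iSup₂_le fun C hC => ?_
  calc ∫⁻ ω in C, g C ω ∂μ
      ≤ sSup {t | ∃ A, IsAtomSigmaFinite μ A ∧ ∫⁻ ω in A, g A ω ∂μ = t} := le_sSup ⟨C, hC, rfl⟩
    _ ≤ ∫⁻ ω in B, g B ω ∂μ := le_of_tendsto hv (Filter.Eventually.of_forall fun n => by
      rw [← hAv n]
      exact hmono _ _ (hA n) hB ((subset_iUnion A n).trans hAB))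

/-- A consistent family with finite exhausting integral vanishes outside a `σ`-finite set. -/
theorem IsConsistentFamily.exists_sigmaFinite_carrier {g : Set Ω → Ω → ℝ≥0∞}
    (hg : IsConsistentFamily μ g)
    (hgm : ∀ A, IsAtomSigmaFinite μ A → AEMeasurable (g A) (μ.restrict A))
    (hfin : exhaustingLIntegral μ g ≠ ∞) :
    ∃ S, IsSigmaFiniteSet μ S ∧
      ∀ A, IsAtomSigmaFinite μ A → ∀ᵐ ω ∂μ.restrict (A \ S), g A ω = 0 := by
  obtain ⟨A₀, hA₀, hA₀max⟩ := hg.exists_lintegral_eq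
  obtain ⟨S, hSA, hS, hSp⟩ := hA₀.exists_sigmaFinite_part
  refine ⟨S, hS, fun A hA => ?_⟩
  have hAA₀ := hA.union hA₀
  have h1 : ∀ᵐ ω ∂μ.restrict (A \ A₀), g (A ∪ A₀) ω = 0 := by
    have hadd := lintegral_inter_add_sdiff (μ := μ) (g (A ∪ A₀)) (A ∪ A₀) hA₀.measurableSet
    rw [union_inter_cancel_right, union_sdiff_right, hA₀max _ hAA₀ subset_union_right,
      ← lintegral_congr_ae (hg _ _ hA₀ hAA₀ subset_union_right), hA₀max _ hA₀ subset_rfl] at hadd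
    have h0 : ∫⁻ ω in A \ A₀, g (A ∪ A₀) ω ∂μ = 0 := by
      rw [← add_zero (exhaustingLIntegral μ g)] at hadd
      exact (ENNReal.add_right_inj hfin).1 (by simpa using hadd)
    exact (lintegral_eq_zero_iff' ((hgm _ hAA₀).mono_measure
      (Measure.restrict_mono (sdiff_subset.trans subset_union_left) le_rfl))).1 h0
  have h2 : ∀ᵐ ω ∂μ.restrict (A₀ \ S), g (A ∪ A₀) ω = 0 := by
    refine hSp _ fun T hTA hT hTi => ?_
    have hT' := hT.isAtomSigmaFinite
    have h0 := hT.ae_eq_zero_of_lintegral_ne_top hTi (hgm T hT')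
      (ne_top_of_le_ne_top hfin (le_exhaustingLIntegral g hT'))
    filter_upwards [h0, hg T _ hT' hAA₀ (hTA.trans subset_union_right)] with ω hω hω'
    rw [← hω', hω]
  have h3 : ∀ᵐ ω ∂μ.restrict (A \ S), g (A ∪ A₀) ω = 0 := by
    refine ae_restrict_of_ae_restrict_of_subset ?_ ((ae_restrict_union_iff _ _ _).2 ⟨h1, h2⟩)
    intro ω hω
    by_cases h : ω ∈ A₀
    · exact .inr ⟨h, hω.2⟩
    · exact .inl ⟨hω.1, h⟩
  filter_upwards [h3, ae_restrict_of_ae_restrict_of_subset sdiff_subset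
    (hg A _ hA hAA₀ subset_union_left)] with ω hω hω'
  rw [hω', hω]

end Exhausting

/-! ### Essential infimum functions over separable sets -/

theorem polishSpace_of_isClosed_of_isSeparable {M : Type*} [MetricSpace M] [CompleteSpace M]
    {W : Set M} (hW : IsClosed W) (hs : TopologicalSpace.IsSeparable W) : PolishSpace W := by
  have := hs.secondCountableTopology
  have := hW.completeSpace_coe
  infer_instance

theorem image_fst_lt_integrand {Ω M : Type*} (f : Ω → M → EReal) (A : Set Ω) (W : Set M)
    (h : Ω → EReal) :
    Prod.fst '' {p : Ω × W | p.1 ∈ A ∧ f p.1 p.2 < h p.1} =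
      A ∩ {ω | ⨅ x ∈ W, f ω x < h ω} := by
  ext ω
  simp [iInf_lt_iff]

theorem IntegrallySeparablyMeasurable.measurableSet_lt {Ω M : Type*} [MeasurableSpace Ω]
    {μ : Measure Ω} [TopologicalSpace M] [MeasurableSpace M] {f : Ω → M → EReal}
    (hf : IntegrallySeparablyMeasurable μ f)
    {A : Set Ω} (hA : IsAtomSigmaFinite μ A) {W : Set M} (hW : TopologicalSpace.IsSeparable W)
    {h : Ω → EReal} (hh : Measurable h) :
    MeasurableSet {p : Ω × W | p.1 ∈ A ∧ f p.1 p.2 < h p.1} := by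
  have hm : MeasurableSet {p : A × W | f p.1 p.2 < h p.1} :=
    _root_.measurableSet_lt (hf A hA W hW) (hh.comp (measurable_subtype_coe.comp measurable_fst))
  have hemb : MeasurableEmbedding (Prod.map ((↑) : A → Ω) (id : W → W)) :=
    .prodMap (.subtype_coe hA.measurableSet) .id
  convert hemb.measurableSet_image.2 hm
  ext ⟨ω, x⟩
  simp [and_comm]

section EssInf

variable {Ω M : Type*} [MeasurableSpace Ω] {μ : Measure Ω} [MetricSpace M] [MeasurableSpace M]
  [BorelSpace M] {f : Ω → M → EReal}

/-- The superposition `ω ↦ f ω (u ω)` is measurable on the countable unions of atoms and sets of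
finite measure, since `u` has separable range there. -/
theorem IntegrallySeparablyMeasurable.aemeasurable_comp
    (hf : IntegrallySeparablyMeasurable μ f) {u : Ω → M} (hu : IntegrallyStronglyMeasurable μ u)
    {A : Set Ω} (hA : IsAtomSigmaFinite μ A) :
    AEMeasurable (fun ω => f ω (u ω)) (μ.restrict A) := by
  have hW : TopologicalSpace.IsSeparable (u '' A) := by
    have := (hu A hA).isSeparable_range
    rwa [range_domRestrict] at this
  rw [aemeasurable_restrict_iff_comap_subtype hA.measurableSet]
  have hm : Measurable fun ω : A => (ω, (⟨u ω, mem_image_of_mem u ω.2⟩ : u '' A)) :=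
    measurable_id.prodMk ((hu A hA).measurable.subtype_mk)
  exact ((hf A hA _ hW).comp hm).aemeasurable

/-- By the projection theorem, the infimum over a closed separable set is measurable for the
completion. -/
theorem IntegrallySeparablyMeasurable.aemeasurable_iInf [CompleteSpace M]
    (hf : IntegrallySeparablyMeasurable μ f) {S : Set Ω} (hS : IsSigmaFiniteSet μ S) {W : Set M}
    (hW : TopologicalSpace.IsSeparable W) (hWc : IsClosed W) :
    AEMeasurable (fun ω => ⨅ x ∈ W, f ω x) (μ.restrict S) := by
  have := hS.sigmaFinite_restrict
  have := polishSpace_of_isClosed_of_isSeparable hWc hW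
  refine NullMeasurable.aemeasurable ?_
  refine measurable_of_Iio (δ := NullMeasurableSpace Ω (μ.restrict S)) fun c => ?_
  have hG := hf.measurableSet_lt hS.isAtomSigmaFinite hW
    (measurable_const (a := c))
  have hn := nullMeasurableSet_image_fst (μ.restrict S) hG
  rw [image_fst_lt_integrand f S W fun _ => c] at hn
  have hae : (S ∩ {ω | ⨅ x ∈ W, f ω x < c} : Set Ω) =ᵐ[μ.restrict S]
      {ω | ⨅ x ∈ W, f ω x < c} := by
    refine Filter.eventuallyEq_set.2 ?_
    filter_upwards [ae_restrict_mem hS.measurableSet] with ω hω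
    simp [hω]
  exact NullMeasurableSet.congr hn hae

/-- On a `σ`-finite set the infima over separable sets have an a.e. least one: separable sets are
closed under countable unions, so for each rational `q` the measure of `{inf_W f < q}` can be
maximized, and this simultaneously for all `q`. -/
theorem IntegrallySeparablyMeasurable.exists_iInf_le_of_sigmaFinite [CompleteSpace M]
    (hf : IntegrallySeparablyMeasurable μ f) {S : Set Ω} (hS : IsSigmaFiniteSet μ S) :
    ∃ W : Set M, TopologicalSpace.IsSeparable W ∧ ∀ W' : Set M, TopologicalSpace.IsSeparable W' →
      ∀ᵐ ω ∂μ.restrict S, ⨅ x ∈ W, f ω x ≤ ⨅ x ∈ W', f ω x := by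
  have := hS.sigmaFinite_restrict
  set ν := (μ.restrict S).toFinite
  have hνae : ae ν = ae (μ.restrict S) := ae_toFinite
  let E : ℚ → Set M → Set Ω := fun q W => {ω | ⨅ x ∈ W, f ω x < ((q : ℝ) : EReal)}
  have hE : ∀ q {W W' : Set M}, W ⊆ W' → E q W ⊆ E q W' := fun q W W' h ω hω =>
    show ⨅ x ∈ W', f ω x < _ from lt_of_le_of_lt (biInf_mono h) hω
  have hmax : ∀ q, ∃ W, TopologicalSpace.IsSeparable W ∧
      ∀ W', TopologicalSpace.IsSeparable W' → ν (E q W') ≤ ν (E q W) := by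
    intro q
    obtain ⟨v, -, hv, hvm⟩ := exists_seq_tendsto_sSup
      (S := {t | ∃ W, TopologicalSpace.IsSeparable W ∧ ν (E q W) = t})
      ⟨_, ∅, countable_empty.isSeparable, rfl⟩ (OrderTop.bddAbove _)
    choose W hW hWv using hvm
    refine ⟨⋃ n, W n, .iUnion hW, fun W' hW' => ?_⟩
    calc ν (E q W') ≤ sSup {t | ∃ W, TopologicalSpace.IsSeparable W ∧ ν (E q W) = t} :=
          le_sSup ⟨W', hW', rfl⟩
      _ ≤ ν (E q (⋃ n, W n)) := le_of_tendsto hv (Filter.Eventually.of_forall fun n => by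
          rw [← hWv n]
          exact measure_mono (hE q (subset_iUnion W n)))
  choose W hW hWmax using hmax
  refine ⟨closure (⋃ q, W q), (TopologicalSpace.IsSeparable.iUnion hW).closure, fun W' hW' => ?_⟩
  have hWc : TopologicalSpace.IsSeparable (closure (⋃ q, W q)) :=
    (TopologicalSpace.IsSeparable.iUnion hW).closure
  have key : ∀ q : ℚ, ∀ᵐ ω ∂μ.restrict S,
      ω ∈ E q (closure (⋃ q, W q) ∪ W') → ω ∈ E q (closure (⋃ q, W q)) := by
    intro q
    have hnull : NullMeasurableSet (E q (closure (⋃ q, W q))) ν :=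
      (nullMeasurableSet_lt (hf.aemeasurable_iInf hS hWc isClosed_closure)
        aemeasurable_const).mono_ac (toFinite_absolutelyContinuous _)
    have h := ae_eq_of_subset_of_measure_ge (μ := ν) (hE q subset_union_left)
      ((hWmax q _ (hWc.union hW')).trans
        (measure_mono (hE q ((subset_iUnion W q).trans subset_closure)))) hnull (measure_ne_top _ _)
    rw [← hνae]
    filter_upwards [Filter.eventuallyEq_set.1 h] with ω hω
    exact hω.2
  filter_upwards [ae_all_iff.2 key] with ω hω
  refine le_of_not_gt fun hlt => ?_
  obtain ⟨q, hq1, hq2⟩ := EReal.lt_iff_exists_rat_btwn.1 hlt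
  exact lt_asymm hq2 (hω q (hE q subset_union_right hq1))

/-- If the infima are nonnegative on infinite atoms and some function has nonpositive superposition
there, the local essential infimum functions exist and are infima over separable sets. -/
theorem IntegrallySeparablyMeasurable.exists_isSepEssInfOn [CompleteSpace M]
    (hf : IntegrallySeparablyMeasurable μ f)
    (hatom : ∀ A : Set Ω, IsMeasureAtom μ A → μ A = ∞ →
      ∀ W : Set M, TopologicalSpace.IsSeparable W → ∀ᵐ ω ∂(μ.restrict A), 0 ≤ ⨅ x ∈ W, f ω x)
    {u : Ω → M} (hu : IntegrallyStronglyMeasurable μ u)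
    (hu0 : ∀ A : Set Ω, IsMeasureAtom μ A → μ A = ∞ → ∀ᵐ ω ∂(μ.restrict A), f ω (u ω) ≤ 0)
    {A : Set Ω} (hA : IsAtomSigmaFinite μ A) :
    ∃ W : Set M, TopologicalSpace.IsSeparable W ∧ IsSepEssInfOn μ f A fun ω => ⨅ x ∈ W, f ω x := by
  obtain ⟨S, hSA, hS, hSp⟩ := hA.exists_sigmaFinite_part
  obtain ⟨W, hW, hWle⟩ := hf.exists_iInf_le_of_sigmaFinite hS
  have hV : TopologicalSpace.IsSeparable (u '' A) := by
    have := (hu A hA).isSeparable_range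
    rwa [range_domRestrict] at this
  have hU : TopologicalSpace.IsSeparable (closure (W ∪ u '' A)) := (hW.union hV).closure
  have hres : μ.restrict A = μ.restrict (S ∪ A \ S) := by rw [union_sdiff_cancel hSA]
  have hzero : ∀ᵐ ω ∂μ.restrict (A \ S), ⨅ x ∈ closure (W ∪ u '' A), f ω x = 0 := by
    refine hSp _ fun T hTA hT hTi => ?_
    filter_upwards [hatom T hT hTi _ hU, hu0 T hT hTi, ae_restrict_mem hT.1] with ω h1 h2 h3
    exact le_antisymm ((iInf₂_le _ (subset_closure (.inr (mem_image_of_mem u (hTA h3))))).trans h2)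
      h1
  have hle : ∀ W', TopologicalSpace.IsSeparable W' → ∀ᵐ ω ∂(μ.restrict A),
      ⨅ x ∈ closure (W ∪ u '' A), f ω x ≤ ⨅ x ∈ W', f ω x := by
    intro W' hW'
    rw [hres, ae_restrict_union_iff]
    constructor
    · filter_upwards [hWle W' hW'] with ω hω
      exact (biInf_mono (subset_union_left.trans subset_closure)).trans hω
    · filter_upwards [hzero, hSp _ fun T _ hT hTi => hatom T hT hTi W' hW'] with ω h1 h2
      rw [h1]
      exact h2
  refine ⟨_, hU, ?_, hle, fun r _ hr => hr _ hU⟩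
  rw [hres, aemeasurable_union_iff]
  exact ⟨hf.aemeasurable_iInf hS hU isClosed_closure, aemeasurable_const.congr
    (hzero.mono fun ω hω => hω.symm)⟩

end EssInf

theorem IsSepEssInfOn.ae_eq {Ω M : Type*} [MeasurableSpace Ω] {μ : Measure Ω} [TopologicalSpace M]
    {f : Ω → M → EReal} {A : Set Ω} {m m' : Ω → EReal} (hm : IsSepEssInfOn μ f A m)
    (hm' : IsSepEssInfOn μ f A m') : ∀ᵐ ω ∂μ.restrict A, m ω = m' ω := by
  filter_upwards [hm.2.2 m' hm'.1 hm'.2.1, hm'.2.2 m hm.1 hm.2.1] with ω h1 h2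
  exact le_antisymm h2 h1

/-! ### The truncated and lifted function `max m (-k) + w` -/

theorem EReal.lt_max_neg_natCast_add {m : EReal} (hm : m ≠ ⊤) (k : ℕ) {w : ℝ} (hw : 0 < w) :
    m < max m (-(k : ℝ) : ℝ) + w := by
  have h1 : max m (-(k : ℝ) : ℝ) ≠ ⊤ := (max_lt hm.lt_top (EReal.coe_lt_top _)).ne
  have h2 : max m (-(k : ℝ) : ℝ) ≠ ⊥ := (lt_max_of_lt_right (EReal.bot_lt_coe _)).ne'
  refine (le_max_left m ((-(k : ℝ) : ℝ) : EReal)).trans_lt ?_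
  lift max m (-(k : ℝ) : ℝ) to ℝ using ⟨h1, h2⟩ with r
  exact_mod_cast lt_add_of_pos_right r hw

theorem EReal.toENNReal_max_neg_natCast_add_le (m : EReal) (k : ℕ) (w : ℝ) :
    (max m (-(k : ℝ) : ℝ) + w).toENNReal ≤ m.toENNReal + ENNReal.ofReal w := by
  refine EReal.toENNReal_add_le.trans (add_le_add ?_ le_rfl)
  rcases le_total m (-(k : ℝ) : ℝ) with h | h
  · rw [max_eq_right h, EReal.toENNReal_of_nonpos]
    · exact zero_le
    · exact_mod_cast neg_nonpos.2 k.cast_nonneg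
  · rw [max_eq_left h]

theorem EReal.min_toENNReal_neg_le {m : EReal} (hm : m ≠ ⊤) (k : ℕ) (w : ℝ) :
    min (-m).toENNReal k ≤
      (-(max m (-(k : ℝ) : ℝ) + w)).toENNReal + ENNReal.ofReal w := by
  have h1 : max m (-(k : ℝ) : ℝ) ≠ ⊤ := (max_lt hm.lt_top (EReal.coe_lt_top _)).ne
  have h2 : max m (-(k : ℝ) : ℝ) ≠ ⊥ := (lt_max_of_lt_right (EReal.bot_lt_coe _)).ne'
  have h3 : min (-m).toENNReal k ≤ (-max m (-(k : ℝ) : ℝ)).toENNReal := by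
    rcases le_total m (-(k : ℝ) : ℝ) with h | h
    · rw [max_eq_right h]
      refine (min_le_right _ _).trans (le_of_eq ?_)
      rw [← EReal.coe_neg, neg_neg, EReal.real_coe_toENNReal, ENNReal.ofReal_natCast]
    · rw [max_eq_left h]
      exact min_le_left _ _
  refine h3.trans ?_
  lift max m (-(k : ℝ) : ℝ) to ℝ using ⟨h1, h2⟩ with r
  have : -(r : EReal) = -((r : EReal) + w) + w := by
    norm_cast
    ring
  rw [this]
  exact EReal.toENNReal_add_le

/-! ### Approximate minimizers -/

/-- A measurable function lying strictly above the infimum over a separable set is a.e. above the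
superposition of a strongly measurable function. -/
theorem IntegrallySeparablyMeasurable.exists_stronglyMeasurable_lt {Ω M : Type*}
    [MeasurableSpace Ω] {μ : Measure Ω} [MetricSpace M] [CompleteSpace M] [MeasurableSpace M]
    [BorelSpace M] {f : Ω → M → EReal} (u₀ : Ω → M)
    (hf : IntegrallySeparablyMeasurable μ f) {S : Set Ω} (hS : IsSigmaFiniteSet μ S) {W : Set M}
    (hW : TopologicalSpace.IsSeparable W) {h : Ω → EReal} (hh : Measurable h)
    (hlt : ∀ᵐ ω ∂μ.restrict S, ⨅ x ∈ W, f ω x < h ω) :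
    ∃ u : Ω → M, StronglyMeasurable u ∧ ∀ᵐ ω ∂μ.restrict S, f ω (u ω) < h ω := by
  rcases isEmpty_or_nonempty Ω with hΩ | ⟨⟨ω₀⟩⟩
  · exact ⟨u₀, .of_discrete, by simp [Measure.eq_zero_of_isEmpty μ]⟩
  let x₀ := u₀ ω₀
  have hV : TopologicalSpace.IsSeparable (closure (insert x₀ W)) := by
    rw [← singleton_union]
    exact ((countable_singleton x₀).isSeparable.union hW).closure
  have : Nonempty (closure (insert x₀ W)) := ⟨⟨x₀, subset_closure (mem_insert _ _)⟩⟩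
  have := polishSpace_of_isClosed_of_isSeparable isClosed_closure hV
  have := hS.sigmaFinite_restrict
  obtain ⟨B, u, hB, hu, huB, h0⟩ := exists_measurable_selection_ae (μ.restrict S)
    (hf.measurableSet_lt hS.isAtomSigmaFinite hV hh)
  rw [image_fst_lt_integrand f S (closure (insert x₀ W)) h] at h0
  refine ⟨fun ω => u ω, continuous_subtype_val.comp_stronglyMeasurable hu.stronglyMeasurable, ?_⟩
  filter_upwards [hlt, measure_eq_zero_iff_ae_notMem.1 h0, ae_restrict_mem hS.measurableSet]
    with ω h1 h2 h3
  have hωB : ω ∈ B := by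
    by_contra hωB
    exact h2 ⟨⟨h3, lt_of_le_of_lt
      (biInf_mono ((subset_insert _ _).trans subset_closure)) h1⟩, hωB⟩
  exact (huB ω hωB).2

/-- If `f ω (u₁ ω) ≤ h ω` on a `σ`-finite set outside of which the positive part of the
superposition of `u₀ ∈ R` vanishes, then some member of `R`, equal to `u₁` on a large part of that
set and to `u₀` elsewhere, does almost as well as `h`. -/
theorem IsAlmostDecomposable.exists_mem_lintegral_le {Ω M : Type*} [MeasurableSpace Ω]
    {μ : Measure Ω} [MetricSpace M] {f : Ω → M → EReal} {R : Set (Ω → M)}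
    (hR : IsAlmostDecomposable μ R) {u₀ : Ω → M} (hu₀ : u₀ ∈ R) {S : Set Ω}
    (hS : IsSigmaFiniteSet μ S)
    (hm : AEMeasurable (fun ω => f ω (u₀ ω)) (μ.restrict S))
    (hcar : ∀ A, IsAtomSigmaFinite μ A →
      ∀ᵐ ω ∂μ.restrict (A \ S), (f ω (u₀ ω)).toENNReal = 0)
    (hfin : ∫⁻ ω in S, (f ω (u₀ ω)).toENNReal ∂μ ≠ ∞) {u₁ : Ω → M} (hu₁ : StronglyMeasurable u₁)
    {h : Ω → EReal} (hh : Measurable h) (hle : ∀ᵐ ω ∂μ.restrict S, f ω (u₁ ω) ≤ h ω)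
    {ε : ℝ≥0∞} (hε : ε ≠ 0) {n : ℝ≥0∞} (hn : n = 0 ∨ n < ∫⁻ ω in S, (-h ω).toENNReal ∂μ) :
    ∃ v ∈ R, exhaustingLIntegral μ (fun _ ω => (f ω (v ω)).toENNReal) ≤
        ∫⁻ ω in S, (h ω).toENNReal ∂μ + ε ∧
      n ≤ exhaustingLIntegral μ (fun _ ω => (-f ω (v ω)).toENNReal) := by
  classical
  have hSa := hS.isAtomSigmaFinite
  have hSm := hS.measurableSet
  rcases isEmpty_or_nonempty Ω with hΩ | ⟨⟨ω₀⟩⟩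
  · have hμ : μ = 0 := Measure.eq_zero_of_isEmpty μ
    subst hμ
    refine ⟨u₀, hu₀, by simp [exhaustingLIntegral], ?_⟩
    rcases hn with rfl | hn
    · exact zero_le
    · simp at hn
  obtain ⟨s, hs, hSs⟩ := id hS
  -- sets of finite measure exhausting `S`, on which `u₁` is bounded
  let F : ℕ → Set Ω := fun k => (⋃ i ∈ Finset.range k, s i) ∩ {ω | dist (u₁ ω) (u₀ ω₀) ≤ k}
  have hFm : ∀ k, MeasurableSet (F k) := fun k =>
    (Finset.measurableSet_biUnion _ fun i _ => (hs i).1).inter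
      (measurableSet_le (hu₁.dist stronglyMeasurable_const).measurable measurable_const)
  have hFfin : ∀ k, μ (F k) < ∞ := fun k =>
    (measure_mono inter_subset_left).trans_lt
      ((measure_biUnion_finset_le _ _).trans_lt (ENNReal.sum_lt_top.2 fun i _ => (hs i).2))
  have hFb : ∀ k, Bornology.IsBounded (u₁ '' F k) := fun k =>
    Metric.isBounded_closedBall.subset (image_subset_iff.2 fun ω hω =>
      show u₁ ω ∈ Metric.closedBall (u₀ ω₀) k from hω.2)
  have hFS : ∀ k, F k ⊆ S := fun k ω hω => by
    rw [hSs]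
    obtain ⟨i, -, hi⟩ := mem_iUnion₂.1 hω.1
    exact mem_iUnion.2 ⟨i, hi⟩
  have hFev : ∀ ω ∈ S, ∀ᶠ k in Filter.atTop, ω ∈ F k := by
    intro ω hω
    rw [hSs] at hω
    obtain ⟨i, hi⟩ := mem_iUnion.1 hω
    obtain ⟨j, hj⟩ := exists_nat_ge (dist (u₁ ω) (u₀ ω₀))
    filter_upwards [Filter.eventually_gt_atTop i, Filter.eventually_ge_atTop j] with k hk hk'
    exact ⟨mem_iUnion₂.2 ⟨i, Finset.mem_range.2 hk, hi⟩, hj.trans (by exact_mod_cast hk')⟩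
  obtain ⟨δ, hδ, hδs⟩ := ENNReal.exists_pos_sum_of_countable' one_ne_zero ℕ
  have hex := fun k => hR u₀ hu₀ (F k) (hFm k) (hFfin k) (δ k) (hδ k) u₁
    (hu₁.comp_measurable measurable_subtype_coe) (hFb k)
  choose E hEm hEF hEδ hER using hex
  have hEev : ∀ᵐ ω ∂μ.restrict S, ∀ᶠ k in Filter.atTop, ω ∈ E k := by
    have hBC : ∀ᵐ ω ∂μ, ∀ᶠ k in Filter.atTop, ω ∉ F k \ E k :=
      ae_eventually_notMem (ne_top_of_le_ne_top ENNReal.one_ne_top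
        ((ENNReal.tsum_le_tsum fun k => (hEδ k).le).trans hδs.le))
    filter_upwards [ae_restrict_of_ae hBC, ae_restrict_mem hSm] with ω h1 h2
    filter_upwards [h1, hFev ω h2] with k hk1 hk2
    by_contra hk
    exact hk1 ⟨hk2, hk⟩
  have hP : ∀ᶠ k in Filter.atTop, ∫⁻ ω in S \ E k, (f ω (u₀ ω)).toENNReal ∂μ ≤ ε := by
    have hlim := tendsto_lintegral_of_dominated_convergence' (μ := μ.restrict S)
      (F := fun k => (E k)ᶜ.indicator fun ω => (f ω (u₀ ω)).toENNReal) (f := 0)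
      (fun ω => (f ω (u₀ ω)).toENNReal)
      (fun k => hm.ereal_toENNReal.indicator (hEm k).compl)
      (fun k => Filter.Eventually.of_forall fun ω => indicator_le_self _ _ ω) hfin (by
        filter_upwards [hEev] with ω hω
        refine tendsto_const_nhds.congr' ?_
        filter_upwards [hω] with k hk
        simp [hk])
    simp only [Pi.zero_apply, lintegral_zero] at hlim
    filter_upwards [hlim.eventually_le_const (pos_iff_ne_zero.2 hε)] with k hk
    rwa [lintegral_indicator (hEm k).compl, Measure.restrict_restrict (hEm k).compl,
      inter_comm, ← sdiff_eq] at hk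
  have hN : ∀ᶠ k in Filter.atTop, n ≤ ∫⁻ ω in E k, (-h ω).toENNReal ∂μ := by
    rcases hn with rfl | hn
    · exact Filter.Eventually.of_forall fun k => zero_le
    have hfatou := lintegral_liminf_le (μ := μ.restrict S) (u := Filter.atTop)
      (f := fun k => (E k).indicator fun ω => (-h ω).toENNReal)
      (fun k => hh.neg.ereal_toENNReal.indicator (hEm k))
    have hlim : ∫⁻ ω in S, Filter.liminf
        (fun k => (E k).indicator (fun ω => (-h ω).toENNReal) ω) Filter.atTop ∂μ =
        ∫⁻ ω in S, (-h ω).toENNReal ∂μ := by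
      refine lintegral_congr_ae ?_
      filter_upwards [hEev] with ω hω
      refine Filter.Tendsto.liminf_eq (tendsto_const_nhds.congr' ?_)
      filter_upwards [hω] with k hk
      simp [hk]
    rw [hlim] at hfatou
    filter_upwards [Filter.eventually_lt_of_lt_liminf (hn.trans_le hfatou)] with k hk
    rw [lintegral_indicator (hEm k), Measure.restrict_restrict (hEm k),
      inter_eq_self_of_subset_left ((hEF k).trans (hFS k))] at hk
    exact hk.le
  obtain ⟨k, hkP, hkN⟩ := (hP.and hN).exists
  have hES : E k ⊆ S := (hEF k).trans (hFS k)
  have hvE : ∀ᵐ ω ∂μ.restrict (E k), f ω ((E k).piecewise u₁ u₀ ω) ≤ h ω := by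
    filter_upwards [ae_restrict_of_ae_restrict_of_subset hES hle, ae_restrict_mem (hEm k)]
      with ω h1 h2
    rwa [piecewise_eq_of_mem _ _ _ h2]
  refine ⟨(E k).piecewise u₁ u₀, by convert hER k, iSup₂_le fun A hA => ?_, ?_⟩
  · rw [← lintegral_inter_add_sdiff _ A (hEm k)]
    refine add_le_add ?_ ?_
    · calc ∫⁻ ω in A ∩ E k, (f ω ((E k).piecewise u₁ u₀ ω)).toENNReal ∂μ
          ≤ ∫⁻ ω in E k, (f ω ((E k).piecewise u₁ u₀ ω)).toENNReal ∂μ :=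
            lintegral_mono_set inter_subset_right
        _ ≤ ∫⁻ ω in E k, (h ω).toENNReal ∂μ :=
            lintegral_mono_ae (hvE.mono fun ω hω => EReal.toENNReal_le_toENNReal hω)
        _ ≤ ∫⁻ ω in S, (h ω).toENNReal ∂μ := lintegral_mono_set hES
    · calc ∫⁻ ω in A \ E k, (f ω ((E k).piecewise u₁ u₀ ω)).toENNReal ∂μ
          = ∫⁻ ω in A \ E k, (f ω (u₀ ω)).toENNReal ∂μ :=
            setLIntegral_congr_fun (hA.measurableSet.diff (hEm k)) fun ω hω => by
              simp only [piecewise_eq_of_notMem _ _ _ hω.2]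
        _ ≤ ∫⁻ ω in (A \ S) ∪ (S \ E k), (f ω (u₀ ω)).toENNReal ∂μ := by
            refine lintegral_mono_set fun ω hω => ?_
            by_cases hωS : ω ∈ S
            · exact .inr ⟨hωS, hω.2⟩
            · exact .inl ⟨hω.1, hωS⟩
        _ ≤ _ := lintegral_union_le _ _ _
        _ ≤ ε := by
            rw [lintegral_congr_ae (hcar A hA), lintegral_zero, zero_add]
            exact hkP
  · calc n ≤ ∫⁻ ω in E k, (-h ω).toENNReal ∂μ := hkN
      _ ≤ ∫⁻ ω in E k, (-f ω ((E k).piecewise u₁ u₀ ω)).toENNReal ∂μ :=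
          lintegral_mono_ae (hvE.mono fun ω hω =>
            EReal.toENNReal_le_toENNReal (EReal.neg_le_neg_iff.2 hω))
      _ ≤ ∫⁻ ω in S, (-f ω ((E k).piecewise u₁ u₀ ω)).toENNReal ∂μ := lintegral_mono_set hES
      _ ≤ _ := le_exhaustingLIntegral
          (fun _ ω => (-f ω ((E k).piecewise u₁ u₀ ω)).toENNReal) hSa

section Interchange

variable {Ω M : Type*} [MeasurableSpace Ω] {μ : Measure Ω} [MetricSpace M] [MeasurableSpace M]
  [BorelSpace M] {f : Ω → M → EReal} {R : Set (Ω → M)}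

/-- The infimum function of a separable set can be approached by the integrands of members of `R`:
`h = max m (-k) + w` with a small integrable `w > 0` lies strictly above it. -/
theorem IsAlmostDecomposable.exists_mem_lintegral_le_of_iInf_eq [CompleteSpace M]
    (hR : IsAlmostDecomposable μ R) (hf : IntegrallySeparablyMeasurable μ f) {u₀ : Ω → M}
    (hu₀ : u₀ ∈ R) {S : Set Ω} (hS : IsSigmaFiniteSet μ S)
    (hu₀m : AEMeasurable (fun ω => f ω (u₀ ω)) (μ.restrict S))
    (hcar : ∀ A, IsAtomSigmaFinite μ A →
      ∀ᵐ ω ∂μ.restrict (A \ S), (f ω (u₀ ω)).toENNReal = 0)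
    (hfin : ∫⁻ ω in S, (f ω (u₀ ω)).toENNReal ∂μ ≠ ∞) {m : Ω → EReal}
    (hm : AEMeasurable m (μ.restrict S)) (hmfin : ∫⁻ ω in S, (m ω).toENNReal ∂μ ≠ ∞) {W : Set M}
    (hW : TopologicalSpace.IsSeparable W) (hWm : ∀ᵐ ω ∂μ.restrict S, ⨅ x ∈ W, f ω x = m ω)
    {ε : ℝ≥0∞} (hε : ε ≠ 0) {n : ℝ≥0∞} (hn : n = 0 ∨ n < ∫⁻ ω in S, (-m ω).toENNReal ∂μ) :
    ∃ v ∈ R, exhaustingLIntegral μ (fun _ ω => (f ω (v ω)).toENNReal) ≤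
        ∫⁻ ω in S, (m ω).toENNReal ∂μ + ε ∧
      n ≤ exhaustingLIntegral μ (fun _ ω => (-f ω (v ω)).toENNReal) := by
  have := hS.sigmaFinite_restrict
  obtain ⟨m', hm'm, hmm'⟩ := hm
  have hpos : ∫⁻ ω in S, (m ω).toENNReal ∂μ = ∫⁻ ω in S, (m' ω).toENNReal ∂μ :=
    lintegral_congr_ae (hmm'.fun_comp EReal.toENNReal)
  have hneg : ∫⁻ ω in S, (-m ω).toENNReal ∂μ = ∫⁻ ω in S, (-m' ω).toENNReal ∂μ :=
    lintegral_congr_ae (hmm'.fun_comp fun t => (-t).toENNReal)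
  rw [hpos] at hmfin ⊢
  rw [hneg] at hn
  have hm'top : ∀ᵐ ω ∂μ.restrict S, m' ω ≠ ⊤ := by
    filter_upwards [ae_lt_top' hm'm.ereal_toENNReal.aemeasurable hmfin] with ω hω
    exact EReal.toENNReal_ne_top_iff.1 hω.ne
  have hε2 : ε / 2 ≠ 0 := (ENNReal.half_pos hε).ne'
  let h : ℕ → (Ω → NNReal) → Ω → EReal := fun k w ω => max (m' ω) (-(k : ℝ) : ℝ) + (w ω : ℝ)
  have hchoice : ∃ (k : ℕ) (η : ℝ≥0∞), η ≠ 0 ∧ η ≤ ε / 2 ∧ ∀ w : Ω → NNReal, Measurable w →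
      ∫⁻ ω in S, w ω ∂μ < η → n = 0 ∨ n < ∫⁻ ω in S, (-h k w ω).toENNReal ∂μ := by
    rcases hn with rfl | hn
    · exact ⟨0, ε / 2, hε2, le_rfl, fun _ _ _ => .inl rfl⟩
    obtain ⟨c, hnc, hc⟩ := exists_between hn
    have hsup : ∫⁻ ω in S, (-m' ω).toENNReal ∂μ =
        ⨆ k : ℕ, ∫⁻ ω in S, min (-m' ω).toENNReal k ∂μ := by
      rw [← lintegral_iSup (f := fun (k : ℕ) ω => min (-m' ω).toENNReal (k : ℝ≥0∞))
        (fun k => hm'm.neg.ereal_toENNReal.min measurable_const)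
        (fun k l hkl ω => min_le_min le_rfl (by exact_mod_cast hkl))]
      refine lintegral_congr fun ω => ?_
      have := inf_iSup_eq (-m' ω).toENNReal (fun k : ℕ => (k : ℝ≥0∞))
      rw [ENNReal.iSup_natCast, inf_top_eq] at this
      exact this
    rw [hsup] at hc
    obtain ⟨k, hk⟩ := lt_iSup_iff.1 hc
    refine ⟨k, min (ε / 2) (c - n), (lt_min (pos_iff_ne_zero.2 hε2) (tsub_pos_of_lt hnc)).ne',
      min_le_left _ _, fun w hw hwη => .inr ?_⟩
    have hle : ∫⁻ ω in S, min (-m' ω).toENNReal k ∂μ ≤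
        ∫⁻ ω in S, (-h k w ω).toENNReal ∂μ + ∫⁻ ω in S, w ω ∂μ := by
      rw [← lintegral_add_right _ hw.coe_nnreal_ennreal]
      refine lintegral_mono_ae ?_
      filter_upwards [hm'top] with ω hω
      have := EReal.min_toENNReal_neg_le hω k (w ω)
      rwa [ENNReal.ofReal_coe_nnreal] at this
    have hnw : n + ∫⁻ ω in S, w ω ∂μ <
        ∫⁻ ω in S, (-h k w ω).toENNReal ∂μ + ∫⁻ ω in S, w ω ∂μ := by
      calc n + ∫⁻ ω in S, w ω ∂μ ≤ n + (c - n) := by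
            gcongr
            exact hwη.le.trans (min_le_right _ _)
        _ = c := add_tsub_cancel_of_le hnc.le
        _ < _ := hk.trans_le hle
    exact lt_of_add_lt_add_right hnw
  obtain ⟨k, η, hη, hηε, hkη⟩ := hchoice
  obtain ⟨w, hw0, hw, hwη⟩ := exists_pos_lintegral_lt_of_sigmaFinite (μ.restrict S) hη
  have hh : Measurable (h k w) :=
    (hm'm.max measurable_const).add hw.coe_nnreal_real.coe_real_ereal
  obtain ⟨u₁, hu₁, hu₁h⟩ := hf.exists_stronglyMeasurable_lt u₀ hS hW hh (by
    filter_upwards [hWm, hmm', hm'top] with ω h1 h2 h3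
    rw [h1, h2]
    exact EReal.lt_max_neg_natCast_add h3 k (hw0 ω))
  obtain ⟨v, hv, hvP, hvN⟩ := hR.exists_mem_lintegral_le hu₀ hS hu₀m hcar hfin hu₁ hh
    (hu₁h.mono fun ω hω => hω.le) hε2 (hkη w hw hwη)
  refine ⟨v, hv, hvP.trans ?_, hvN⟩
  calc ∫⁻ ω in S, (h k w ω).toENNReal ∂μ + ε / 2
      ≤ ∫⁻ ω in S, ((m' ω).toENNReal + w ω) ∂μ + ε / 2 := by
        gcongr with ω
        have := EReal.toENNReal_max_neg_natCast_add_le (m' ω) k (w ω)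
        rwa [ENNReal.ofReal_coe_nnreal] at this
    _ = ∫⁻ ω in S, (m' ω).toENNReal ∂μ + ∫⁻ ω in S, w ω ∂μ + ε / 2 := by
        rw [lintegral_add_right _ hw.coe_nnreal_ennreal]
    _ ≤ ∫⁻ ω in S, (m' ω).toENNReal ∂μ + ε / 2 + ε / 2 := by
        gcongr
        exact hwη.le.trans hηε
    _ = _ := by rw [add_assoc, ENNReal.add_halves]

end Interchange

/-! ### Local and global essential infimum functions -/

section Local

variable {Ω M : Type*} [MeasurableSpace Ω] {μ : Measure Ω} [TopologicalSpace M]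
  {f : Ω → M → EReal}

theorem IsSepEssInfOn.congr {A : Set Ω} {m m' : Ω → EReal} (hm : IsSepEssInfOn μ f A m)
    (h : ∀ᵐ ω ∂μ.restrict A, m ω = m' ω) : IsSepEssInfOn μ f A m' := by
  refine ⟨hm.1.congr h, fun W hW => ?_, fun r hr hrle => ?_⟩
  · filter_upwards [hm.2.1 W hW, h] with ω h1 h2
    rwa [← h2]
  · filter_upwards [hm.2.2 r hr hrle, h] with ω h1 h2
    rwa [← h2]

theorem IsSepEssInfOn.exists_iInf_eq {A : Set Ω}
    (hex : ∃ W : Set M, IsSeparable W ∧ IsSepEssInfOn μ f A fun ω => ⨅ x ∈ W, f ω x)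
    {m : Ω → EReal} (hm : IsSepEssInfOn μ f A m) :
    ∃ W : Set M, IsSeparable W ∧ ∀ᵐ ω ∂μ.restrict A, ⨅ x ∈ W, f ω x = m ω := by
  obtain ⟨W, hW, hWm⟩ := hex
  exact ⟨W, hW, hWm.ae_eq hm⟩

theorem IsSepEssInfOn.mono {A B : Set Ω} (hAB : A ⊆ B)
    (hex : ∃ W : Set M, IsSeparable W ∧ IsSepEssInfOn μ f B fun ω => ⨅ x ∈ W, f ω x)
    {m : Ω → EReal} (hm : IsSepEssInfOn μ f B m) : IsSepEssInfOn μ f A m := by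
  obtain ⟨W, hW, hWm⟩ := hm.exists_iInf_eq hex
  refine ⟨hm.1.mono_measure (Measure.restrict_mono hAB le_rfl), fun V hV =>
    ae_restrict_of_ae_restrict_of_subset hAB (hm.2.1 V hV), fun r _ hr => ?_⟩
  filter_upwards [hr W hW, ae_restrict_of_ae_restrict_of_subset hAB hWm] with ω h1 h2
  rwa [← h2]

theorem isConsistentFamily_of_isSepEssInfOn
    (hex : ∀ A, IsAtomSigmaFinite μ A →
      ∃ W : Set M, IsSeparable W ∧ IsSepEssInfOn μ f A fun ω => ⨅ x ∈ W, f ω x)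
    {m : Set Ω → Ω → EReal} (hm : ∀ A, IsAtomSigmaFinite μ A → IsSepEssInfOn μ f A (m A)) :
    IsConsistentFamily μ m := fun A B hA hB hAB =>
  (hm A hA).ae_eq ((hm B hB).mono hAB (hex B hB))

theorem IsSepEssInfOn.ae_le_comp {A : Set Ω} (hA : IsAtomSigmaFinite μ A) {m : Ω → EReal}
    (hm : IsSepEssInfOn μ f A m) [PseudoMetrizableSpace M] {u : Ω → M}
    (hu : IntegrallyStronglyMeasurable μ u) : ∀ᵐ ω ∂μ.restrict A, m ω ≤ f ω (u ω) := by
  have hV : IsSeparable (u '' A) := by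
    have := (hu A hA).isSeparable_range
    rwa [range_domRestrict] at this
  filter_upwards [hm.2.1 _ hV, ae_restrict_mem hA.measurableSet] with ω h1 h2
  exact h1.trans (iInf₂_le _ (mem_image_of_mem u h2))

/-- A function that is locally the essential infimum function is so globally. -/
theorem isSepEssInf_of_forall_isSepEssInfOn {m : Ω → EReal} (hmm : AEMeasurable m μ)
    (hm : ∀ A, IsAtomSigmaFinite μ A → IsSepEssInfOn μ f A m) : IsSepEssInf μ f m := by
  refine ⟨hmm, fun W hW A hA => (hm A hA).2.1 W hW, fun r hr hrle => ?_⟩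
  refine (integrallyAE_iff_ae μ _ ?_).1 fun A hA =>
    (hm A hA).2.2 r hr.restrict fun W hW => hrle W hW A hA
  exact (nullMeasurableSet_le hr hmm).compl

theorem IsSepEssInf.ae_eq {m m' : Ω → EReal} (hm : IsSepEssInf μ f m)
    (hm' : IsSepEssInf μ f m') : ∀ᵐ ω ∂μ, m ω = m' ω := by
  filter_upwards [hm.2.2 m' hm'.1 hm'.2.1, hm'.2.2 m hm.1 hm.2.1] with ω h1 h2
  exact le_antisymm h2 h1

end Local

/-! ### The interchange formula -/

theorem integralFunctional_eq {Ω M : Type*} [MeasurableSpace Ω] (μ : Measure Ω)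
    (f : Ω → M → EReal) (u : Ω → M) :
    integralFunctional μ f u = exhaustingIntegralFamily μ fun _ ω => f ω (u ω) :=
  rfl

section Formula

variable {Ω M : Type*} [MeasurableSpace Ω] {μ : Measure Ω} [MetricSpace M] [MeasurableSpace M]
  [BorelSpace M] {f : Ω → M → EReal} {R : Set (Ω → M)}

/-- The superposition of a function with `I_f(u) ≠ ∞` is nonpositive on infinite atoms. -/
theorem ae_nonpos_of_integralFunctional_ne_top (hf : IntegrallySeparablyMeasurable μ f)
    {u : Ω → M} (hu : IntegrallyStronglyMeasurable μ u) (hfin : integralFunctional μ f u ≠ ⊤)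
    {T : Set Ω} (hT : IsMeasureAtom μ T) (hTi : μ T = ∞) :
    ∀ᵐ ω ∂μ.restrict T, f ω (u ω) ≤ 0 := by
  have h := hT.ae_eq_zero_of_lintegral_ne_top hTi
    (hf.aemeasurable_comp hu hT.isAtomSigmaFinite).ereal_toENNReal
    (ne_top_of_le_ne_top (exhaustingLIntegral_ne_top_of_ne_top hfin)
      (le_exhaustingLIntegral (fun _ ω => (f ω (u ω)).toENNReal) hT.isAtomSigmaFinite))
  exact h.mono fun ω hω => EReal.toENNReal_eq_zero_iff.1 hω

/-- The inequality `inf I_f ≤ ∫ ess inf` in the interchange formula. -/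
theorem iInf_integralFunctional_le [CompleteSpace M]
    (hR : ∀ u ∈ R, IntegrallyStronglyMeasurable μ u) (hRdec : IsAlmostDecomposable μ R)
    (hf : IntegrallySeparablyMeasurable μ f)
    (hatom : ∀ A : Set Ω, IsMeasureAtom μ A → μ A = ∞ →
      ∀ W : Set M, TopologicalSpace.IsSeparable W → ∀ᵐ ω ∂(μ.restrict A), 0 ≤ ⨅ x ∈ W, f ω x)
    {u₀ : Ω → M} (hu₀ : u₀ ∈ R) (hfin : integralFunctional μ f u₀ ≠ ⊤)
    (hex : ∀ A, IsAtomSigmaFinite μ A → ∃ W : Set M, TopologicalSpace.IsSeparable W ∧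
      IsSepEssInfOn μ f A fun ω => ⨅ x ∈ W, f ω x)
    {m : Set Ω → Ω → EReal} (hm : ∀ A, IsAtomSigmaFinite μ A → IsSepEssInfOn μ f A (m A)) :
    (⨅ u ∈ R, integralFunctional μ f u) ≤ exhaustingIntegralFamily μ m := by
  have hcons := isConsistentFamily_of_isSepEssInfOn hex hm
  have hP₀ : exhaustingLIntegral μ (fun _ ω => (f ω (u₀ ω)).toENNReal) ≠ ∞ :=
    exhaustingLIntegral_ne_top_of_ne_top hfin
  have hPle : exhaustingLIntegral μ (fun A ω => (m A ω).toENNReal) ≤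
      exhaustingLIntegral μ (fun _ ω => (f ω (u₀ ω)).toENNReal) :=
    exhaustingLIntegral_mono fun A hA => ((hm A hA).ae_le_comp hA (hR u₀ hu₀)).mono
      fun ω hω => EReal.toENNReal_le_toENNReal hω
  have hP := ne_top_of_le_ne_top hP₀ hPle
  obtain ⟨S₀, hS₀, hS₀c⟩ := (isConsistentFamily_const (μ := μ)
    fun ω => (f ω (u₀ ω)).toENNReal).exists_sigmaFinite_carrier
      (fun A hA => (hf.aemeasurable_comp (hR u₀ hu₀) hA).ereal_toENNReal) hP₀
  set P := exhaustingLIntegral μ (fun A ω => (m A ω).toENNReal)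
  set N := exhaustingLIntegral μ (fun A ω => (-m A ω).toENNReal)
  -- members of `R` are as good as the bound allows on a `σ`-finite set that carries the negative
  -- part of the essential infimum function almost completely
  have key : ∀ ε : ℝ≥0∞, ε ≠ 0 → ∀ n : ℝ≥0∞, n = 0 ∨ n < N →
      (⨅ u ∈ R, integralFunctional μ f u) ≤ ((P + ε : ℝ≥0∞) : EReal) - (n : EReal) := by
    intro ε hε n hn
    have hS : ∃ S, IsSigmaFiniteSet μ S ∧ S₀ ⊆ S ∧
        (n = 0 ∨ n < ∫⁻ ω in S, (-m S ω).toENNReal ∂μ) := by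
      rcases hn with rfl | hn
      · exact ⟨S₀, hS₀, subset_rfl, .inl rfl⟩
      obtain ⟨A, hn⟩ := lt_iSup_iff.1 hn
      obtain ⟨hA, hn⟩ := lt_iSup_iff.1 hn
      obtain ⟨S, hSA, hS, hSp⟩ := hA.exists_sigmaFinite_part
      have hzero : ∀ᵐ ω ∂μ.restrict (A \ S), m A ω = 0 := by
        refine hSp _ fun T hTA hT hTi => ?_
        obtain ⟨W, hW, hWm⟩ := (hm A hA).exists_iInf_eq (hex A hA)
        filter_upwards [hatom T hT hTi W hW, ae_restrict_of_ae_restrict_of_subset hTA hWm,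
          ae_restrict_of_ae_restrict_of_subset hTA ((hm A hA).ae_le_comp hA (hR u₀ hu₀)),
          ae_nonpos_of_integralFunctional_ne_top hf (hR u₀ hu₀) hfin hT hTi] with ω h1 h2 h3 h4
        exact le_antisymm (h3.trans h4) (h2 ▸ h1)
      refine ⟨S ∪ S₀, hS.union hS₀, subset_union_right, .inr (hn.trans_le ?_)⟩
      have hSU := (hS.union hS₀).isAtomSigmaFinite
      rw [← lintegral_inter_add_sdiff _ A hS.measurableSet, inter_eq_self_of_subset_right hSA]
      have h0 : ∫⁻ ω in A \ S, (-m A ω).toENNReal ∂μ = 0 := by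
        rw [lintegral_congr_ae (g := fun _ => 0) (hzero.mono fun ω hω => by simp [hω]),
          lintegral_zero]
      rw [h0, add_zero]
      calc ∫⁻ ω in S, (-m A ω).toENNReal ∂μ
          = ∫⁻ ω in S, (-m (S ∪ S₀) ω).toENNReal ∂μ := by
            refine lintegral_congr_ae ?_
            filter_upwards [hcons S A hS.isAtomSigmaFinite hA hSA,
              hcons S _ hS.isAtomSigmaFinite hSU subset_union_left] with ω h1 h2
            rw [← h1, ← h2]
        _ ≤ _ := lintegral_mono_set subset_union_left
    obtain ⟨S, hS, hS₀S, hnS⟩ := hS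
    have hSa := hS.isAtomSigmaFinite
    obtain ⟨W, hW, hWm⟩ := (hm S hSa).exists_iInf_eq (hex S hSa)
    have hPS : ∫⁻ ω in S, (m S ω).toENNReal ∂μ ≤ P :=
      le_exhaustingLIntegral (fun A ω => (m A ω).toENNReal) hSa
    obtain ⟨v, hv, hvP, hvN⟩ := hRdec.exists_mem_lintegral_le_of_iInf_eq hf hu₀ hS
      (hf.aemeasurable_comp (hR u₀ hu₀) hSa)
      (fun A hA => ae_restrict_of_ae_restrict_of_subset
        (sdiff_subset_sdiff_right hS₀S) (hS₀c A hA))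
      (ne_top_of_le_ne_top hP₀
        (le_exhaustingLIntegral (fun _ ω => (f ω (u₀ ω)).toENNReal) hSa))
      (hm S hSa).1 (ne_top_of_le_ne_top hP hPS) hW hWm
      (ε := min ε 1) (lt_min (pos_iff_ne_zero.2 hε) one_pos).ne' hnS
    have hvtop : exhaustingLIntegral μ (fun _ ω => (f ω (v ω)).toENNReal) ≠ ∞ :=
      ne_top_of_le_ne_top (ENNReal.add_ne_top.2 ⟨ne_top_of_le_ne_top hP hPS,
        ne_top_of_le_ne_top ENNReal.one_ne_top (min_le_right _ _)⟩) hvP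
    refine (iInf₂_le v hv).trans ?_
    rw [integralFunctional_eq, exhaustingIntegralFamily_eq, if_neg hvtop]
    refine EReal.sub_le_sub ?_ (by exact_mod_cast hvN)
    exact_mod_cast hvP.trans (add_le_add hPS (min_le_left _ _))
  rw [exhaustingIntegralFamily_eq, if_neg hP]
  have hseq : ∃ n : ℕ → ℝ≥0∞, (∀ j, n j = 0 ∨ n j < N) ∧
      Filter.Tendsto n Filter.atTop (nhds N) := by
    rcases eq_or_ne N 0 with h0 | h0
    · exact ⟨fun _ => 0, fun _ => .inl rfl, by rw [h0]; exact tendsto_const_nhds⟩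
    · obtain ⟨n, -, hn, hlim⟩ := exists_seq_strictMono_tendsto' (pos_iff_ne_zero.2 h0)
      exact ⟨n, fun j => .inr (hn j).2, hlim⟩
  obtain ⟨n, hn, hnlim⟩ := hseq
  have hε : Filter.Tendsto (fun j : ℕ => P + ((j : ℝ≥0∞))⁻¹) Filter.atTop (nhds P) := by
    simpa using tendsto_const_nhds.add ENNReal.tendsto_inv_nat_nhds_zero
  have hlim : Filter.Tendsto
      (fun j : ℕ => ((P + ((j : ℝ≥0∞))⁻¹ : ℝ≥0∞) : EReal) - (n j : EReal))
      Filter.atTop (nhds ((P : EReal) - (N : EReal))) := by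
    have h1 := (continuous_coe_ennreal_ereal.tendsto P).comp hε
    have h2 := ((continuous_neg.comp continuous_coe_ennreal_ereal).tendsto N).comp hnlim
    simp only [sub_eq_add_neg]
    exact (EReal.continuousAt_add (p := ((P : EReal), -(N : EReal)))
      (.inl (by simpa using hP)) (.inl (by simp))).tendsto.comp (h1.prodMk_nhds h2)
  exact ge_of_tendsto hlim (Filter.Eventually.of_forall fun j =>
    key _ (ENNReal.inv_ne_zero.2 (ENNReal.natCast_ne_top j)) _ (hn j))

end Formula

theorem le_iInf_integralFunctional {Ω M : Type*} [MeasurableSpace Ω] {μ : Measure Ω}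
    [MetricSpace M] {f : Ω → M → EReal} {R : Set (Ω → M)}
    (hR : ∀ u ∈ R, IntegrallyStronglyMeasurable μ u)
    {m : Set Ω → Ω → EReal} (hm : ∀ A, IsAtomSigmaFinite μ A → IsSepEssInfOn μ f A (m A)) :
    exhaustingIntegralFamily μ m ≤ ⨅ u ∈ R, integralFunctional μ f u :=
  le_iInf₂ fun u hu => exhaustingIntegralFamily_mono fun A hA =>
    (hm A hA).ae_le_comp hA (hR u hu)

/-! ### Equality of exhausting integrals -/

theorem EReal.eq_of_toENNReal_eq {x y : EReal} (h : x.toENNReal = y.toENNReal)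
    (h' : (-x).toENNReal = (-y).toENNReal) : x = y := by
  have h1 : max 0 x = max 0 y := by
    rw [← EReal.coe_toENNReal_eq_max, ← EReal.coe_toENNReal_eq_max, h]
  have h2 : max 0 (-x) = max 0 (-y) := by
    rw [← EReal.coe_toENNReal_eq_max, ← EReal.coe_toENNReal_eq_max, h']
  rcases le_total 0 x with hx | hx <;> rcases le_total 0 y with hy | hy
  · rwa [max_eq_right hx, max_eq_right hy] at h1
  · rw [max_eq_right hx, max_eq_left hy] at h1
    rw [max_eq_left (EReal.neg_le_zero.2 hx), max_eq_right (EReal.neg_nonneg.2 hy)] at h2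
    rw [h1, ← neg_neg y, ← h2, neg_zero]
  · rw [max_eq_left hx, max_eq_right hy] at h1
    rw [max_eq_right (EReal.neg_nonneg.2 hx), max_eq_left (EReal.neg_le_zero.2 hy)] at h2
    rw [← h1, ← neg_neg x, h2, neg_zero]
  · rw [max_eq_right (EReal.neg_nonneg.2 hx), max_eq_right (EReal.neg_nonneg.2 hy)] at h2
    exact neg_injective h2

theorem EReal.eq_and_eq_of_sub_le_sub {p q p' q' : ℝ≥0∞} (hp : p ≤ p') (hq : q' ≤ q)
    (hp' : p' ≠ ∞) (hq0 : q ≠ ∞) (h : (p' : EReal) - q' ≤ (p : EReal) - q) :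
    p' = p ∧ q' = q := by
  lift p' to NNReal using hp'
  lift q to NNReal using hq0
  lift p to NNReal using ne_top_of_le_ne_top ENNReal.coe_ne_top hp
  lift q' to NNReal using ne_top_of_le_ne_top ENNReal.coe_ne_top hq
  have h' : ((p' : ℝ) : EReal) - ((q' : ℝ) : EReal) ≤ ((p : ℝ) : EReal) - ((q : ℝ) : EReal) := h
  norm_cast at h' hp hq ⊢
  have h1 : (p : ℝ) ≤ p' := hp
  have h2 : (q' : ℝ) ≤ q := hq
  have h3 : (p' : ℝ) - q' ≤ p - q := by exact_mod_cast h'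
  exact ⟨NNReal.eq (by linarith), NNReal.eq (by linarith)⟩

theorem ae_restrict_eq_of_exhaustingLIntegral_le {Ω : Type*} [MeasurableSpace Ω] {μ : Measure Ω}
    {g h : Ω → ℝ≥0∞} (hh : ∀ A, IsAtomSigmaFinite μ A → AEMeasurable h (μ.restrict A))
    (hgh : ∀ A, IsAtomSigmaFinite μ A → ∀ᵐ ω ∂μ.restrict A, g ω ≤ h ω)
    (hfin : exhaustingLIntegral μ (fun _ => g) ≠ ∞)
    (hle : exhaustingLIntegral μ (fun _ => h) ≤ exhaustingLIntegral μ (fun _ => g)) {A : Set Ω}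
    (hA : IsAtomSigmaFinite μ A) : ∀ᵐ ω ∂μ.restrict A, g ω = h ω := by
  obtain ⟨B, hB, hBmax⟩ := (isConsistentFamily_const (μ := μ) g).exists_lintegral_eq
  have hAB := hA.union hB
  have hmax := hBmax _ hAB subset_union_right
  refine ae_restrict_of_ae_restrict_of_subset subset_union_left
    (ae_eq_of_ae_le_of_lintegral_le (hgh _ hAB) (by rwa [hmax]) (hh _ hAB) ?_)
  rw [hmax]
  exact (le_exhaustingLIntegral (fun _ => h) hAB).trans hle

/-- Functions `α ≤ β` with the same finite exhausting integral coincide i.a.e. -/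
theorem integrallyAE_eq_of_exhaustingIntegral_le {Ω : Type*} [MeasurableSpace Ω] {μ : Measure Ω}
    {α β : Ω → EReal} (hα : ∀ A, IsAtomSigmaFinite μ A → AEMeasurable α (μ.restrict A))
    (hβ : ∀ A, IsAtomSigmaFinite μ A → AEMeasurable β (μ.restrict A))
    (hαβ : ∀ A, IsAtomSigmaFinite μ A → ∀ᵐ ω ∂μ.restrict A, α ω ≤ β ω)
    (hbot : exhaustingIntegral μ α ≠ ⊥) (htop : exhaustingIntegral μ α ≠ ⊤)
    (hle : exhaustingIntegral μ β ≤ exhaustingIntegral μ α) :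
    IntegrallyAE μ fun ω => β ω = α ω := by
  have hPα := exhaustingLIntegral_ne_top_of_ne_top htop
  have hPβ := exhaustingLIntegral_ne_top_of_ne_top (ne_top_of_le_ne_top htop hle)
  unfold exhaustingIntegral at hbot hle
  rw [exhaustingIntegralFamily_eq fun _ => α, if_neg hPα] at hbot hle
  rw [exhaustingIntegralFamily_eq fun _ => β, if_neg hPβ] at hle
  have hNα : exhaustingLIntegral μ (fun _ ω => (-α ω).toENNReal) ≠ ∞ := by
    intro h
    exact hbot (by rw [h, EReal.coe_ennreal_top, EReal.sub_top])
  have hpos : ∀ A, IsAtomSigmaFinite μ A →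
      ∀ᵐ ω ∂μ.restrict A, (α ω).toENNReal ≤ (β ω).toENNReal := fun A hA =>
    (hαβ A hA).mono fun ω hω => EReal.toENNReal_le_toENNReal hω
  have hneg : ∀ A, IsAtomSigmaFinite μ A →
      ∀ᵐ ω ∂μ.restrict A, (-β ω).toENNReal ≤ (-α ω).toENNReal := fun A hA =>
    (hαβ A hA).mono fun ω hω => EReal.toENNReal_le_toENNReal (EReal.neg_le_neg_iff.2 hω)
  have hNle := exhaustingLIntegral_mono (μ := μ) (g := fun _ ω => (-β ω).toENNReal)
    (g' := fun _ ω => (-α ω).toENNReal) hneg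
  obtain ⟨h1, h2⟩ := EReal.eq_and_eq_of_sub_le_sub (exhaustingLIntegral_mono hpos)
    hNle hPβ hNα hle
  intro A hA
  filter_upwards [ae_restrict_eq_of_exhaustingLIntegral_le
      (fun A hA => (hβ A hA).ereal_toENNReal) hpos hPα h1.le hA,
    ae_restrict_eq_of_exhaustingLIntegral_le
      (fun A hA => (hα A hA).neg.ereal_toENNReal) hneg (ne_top_of_le_ne_top hNα hNle) h2.ge hA]
    with ω h3 h4
  exact EReal.eq_of_toENNReal_eq h3.symm h4

/-! ### Global essential infimum functions and minimizers -/

/-- A consistent family `m` of local essential infimum functions whose exhausting integral is finite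
vanishes outside a `σ`-finite set; extension by zero from there gives a global one. The `σ`-finite
set can be taken to carry the positive part of a given superposition as well. -/
theorem exists_measurable_isSepEssInfOn {Ω M : Type*} [MeasurableSpace Ω] {μ : Measure Ω}
    [MetricSpace M] [MeasurableSpace M] [BorelSpace M] {f : Ω → M → EReal}
    (hf : IntegrallySeparablyMeasurable μ f) {u₀ : Ω → M} (hu₀ : IntegrallyStronglyMeasurable μ u₀)
    (hfin : integralFunctional μ f u₀ ≠ ⊤)
    (hex : ∀ A, IsAtomSigmaFinite μ A → ∃ W : Set M, TopologicalSpace.IsSeparable W ∧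
      IsSepEssInfOn μ f A fun ω => ⨅ x ∈ W, f ω x)
    {m : Set Ω → Ω → EReal} (hm : ∀ A, IsAtomSigmaFinite μ A → IsSepEssInfOn μ f A (m A))
    (hbot : exhaustingIntegralFamily μ m ≠ ⊥) (htop : exhaustingIntegralFamily μ m ≠ ⊤) :
    ∃ (S : Set Ω) (m₀ : Ω → EReal), IsSigmaFiniteSet μ S ∧ Measurable m₀ ∧
      (∀ A, IsAtomSigmaFinite μ A → IsSepEssInfOn μ f A m₀) ∧ (∀ ω ∉ S, m₀ ω = 0) ∧
      ∀ A, IsAtomSigmaFinite μ A → ∀ᵐ ω ∂μ.restrict (A \ S), f ω (u₀ ω) ≤ 0 := by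
  have hcons := isConsistentFamily_of_isSepEssInfOn hex hm
  have hP := exhaustingLIntegral_ne_top_of_ne_top htop
  have hN : exhaustingLIntegral μ (fun A ω => (-m A ω).toENNReal) ≠ ∞ := by
    intro h
    rw [exhaustingIntegralFamily_eq, if_neg hP, h, EReal.coe_ennreal_top, EReal.sub_top] at hbot
    exact hbot rfl
  obtain ⟨S₁, hS₁, hS₁c⟩ := (hcons.comp EReal.toENNReal).exists_sigmaFinite_carrier
    (fun A hA => (hm A hA).1.ereal_toENNReal) hP
  obtain ⟨S₂, hS₂, hS₂c⟩ := (hcons.comp fun t => (-t).toENNReal).exists_sigmaFinite_carrier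
    (fun A hA => (hm A hA).1.neg.ereal_toENNReal) hN
  obtain ⟨S₀, hS₀, hS₀c⟩ := (isConsistentFamily_const (μ := μ)
    fun ω => (f ω (u₀ ω)).toENNReal).exists_sigmaFinite_carrier
      (fun A hA => (hf.aemeasurable_comp hu₀ hA).ereal_toENNReal)
      (exhaustingLIntegral_ne_top_of_ne_top hfin)
  have hS : IsSigmaFiniteSet μ (S₀ ∪ (S₁ ∪ S₂)) := hS₀.union (hS₁.union hS₂)
  set S := S₀ ∪ (S₁ ∪ S₂)
  have hSa := hS.isAtomSigmaFinite
  have hSm := hS.measurableSet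
  have hS₁S : S₁ ⊆ S := subset_union_left.trans subset_union_right
  have hS₂S : S₂ ⊆ S := subset_union_right.trans subset_union_right
  have hzero : ∀ A, IsAtomSigmaFinite μ A → ∀ᵐ ω ∂μ.restrict (A \ S), m A ω = 0 := by
    intro A hA
    filter_upwards [ae_restrict_of_ae_restrict_of_subset (sdiff_subset_sdiff_right hS₁S)
        (hS₁c A hA), ae_restrict_of_ae_restrict_of_subset (sdiff_subset_sdiff_right hS₂S)
        (hS₂c A hA)] with ω h1 h2
    exact EReal.eq_of_toENNReal_eq (by simpa using h1) (by simpa using h2)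
  obtain ⟨g, hg, hgm⟩ := (hm S hSa).1
  refine ⟨S, S.indicator g, hS, hg.indicator hSm, fun A hA => (hm A hA).congr ?_,
    fun ω hω => indicator_of_notMem hω g, fun A hA => ?_⟩
  · have hres : μ.restrict A = μ.restrict ((A ∩ S) ∪ (A \ S)) := by rw [inter_union_sdiff]
    rw [hres, ae_restrict_union_iff]
    have hAS := hA.union hSa
    constructor
    · filter_upwards [ae_restrict_of_ae_restrict_of_subset inter_subset_left
          (hcons A _ hA hAS subset_union_left), ae_restrict_of_ae_restrict_of_subset
          inter_subset_right (hcons S _ hSa hAS subset_union_right),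
        ae_restrict_of_ae_restrict_of_subset inter_subset_right hgm,
        ae_restrict_mem (hA.measurableSet.inter hSm)] with ω h1 h2 h3 h4
      rw [h1, ← h2, h3, indicator_of_mem h4.2]
    · filter_upwards [hzero A hA, ae_restrict_mem (hA.measurableSet.diff hSm)] with ω h1 h2
      rw [h1, indicator_of_notMem h2.2]
  · filter_upwards [ae_restrict_of_ae_restrict_of_subset
      (sdiff_subset_sdiff_right subset_union_left) (hS₀c A hA)] with ω hω
    exact EReal.toENNReal_eq_zero_iff.1 hω

theorem mainTheorem4 {Ω M : Type*} [MeasurableSpace Ω] (μ : Measure Ω)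
    [MetricSpace M] [CompleteSpace M] [MeasurableSpace M] [BorelSpace M]
    (R : Set (Ω → M))
    (hR : ∀ u ∈ R, IntegrallyStronglyMeasurable μ u)
    (hRdec : IsAlmostDecomposable μ R)
    (f : Ω → M → EReal) (hf : IntegrallySeparablyMeasurable μ f)
    (hatom : ∀ A : Set Ω, IsMeasureAtom μ A → μ A = ∞ → ∀ W : Set M, IsSeparable W →
      ∀ᵐ ω ∂(μ.restrict A), 0 ≤ ⨅ x ∈ W, f ω x)
    (hfin : ∃ u ∈ R, integralFunctional μ f u ≠ ⊤) :
    -- the local essential infimum functions exist, and the interchange formula holds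
    (∃ m : Set Ω → Ω → EReal, ∀ A, IsAtomSigmaFinite μ A → IsSepEssInfOn μ f A (m A)) ∧
    (∀ m : Set Ω → Ω → EReal, (∀ A, IsAtomSigmaFinite μ A → IsSepEssInfOn μ f A (m A)) →
      (⨅ u ∈ R, integralFunctional μ f u) = exhaustingIntegralFamily μ m) ∧
    -- if the value is not `-∞`, there is a global essential infimum function
    ((⨅ u ∈ R, integralFunctional μ f u) ≠ ⊥ →
      (∃ m : Ω → EReal, IsSepEssInf μ f m) ∧
      ∀ m : Ω → EReal, IsSepEssInf μ f m →
        (⨅ u ∈ R, integralFunctional μ f u) = exhaustingIntegral μ m ∧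
        -- attainment on each `σ`-finite set or atom, and on all of `Ω`
        (∀ A, IsAtomSigmaFinite μ A → ∃ W : Set M, IsSeparable W ∧
          ∀ᵐ ω ∂(μ.restrict A), (⨅ x ∈ W, f ω x) = m ω) ∧
        ((∀ u ∈ R, IsSeparable (range u)) → ∃ W : Set M, IsSeparable W ∧
          IntegrallyAE μ (fun ω => (⨅ x ∈ W, f ω x) = m ω)) ∧
        -- pointwise characterization of minimizers
        (∀ v ∈ R, IsMinOn (integralFunctional μ f) R v ↔
          IntegrallyAE μ (fun ω => f ω (v ω) = m ω)) ∧
        (∀ v ∈ R, AEMeasurable (fun ω => f ω (v ω)) μ →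
          (IsMinOn (integralFunctional μ f) R v ↔ ∀ᵐ ω ∂μ, f ω (v ω) = m ω))) := by
  obtain ⟨u₀, hu₀, hu₀fin⟩ := hfin
  have hu₀m := hR u₀ hu₀
  have hex : ∀ A, IsAtomSigmaFinite μ A → ∃ W : Set M, TopologicalSpace.IsSeparable W ∧
      IsSepEssInfOn μ f A fun ω => ⨅ x ∈ W, f ω x := fun A hA =>
    hf.exists_isSepEssInfOn hatom hu₀m
      (fun T hT hTi => ae_nonpos_of_integralFunctional_ne_top hf hu₀m hu₀fin hT hTi) hA
  have hexm : ∃ m : Set Ω → Ω → EReal, ∀ A, IsAtomSigmaFinite μ A → IsSepEssInfOn μ f A (m A) := by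
    have : ∀ A, ∃ m : Ω → EReal, IsAtomSigmaFinite μ A → IsSepEssInfOn μ f A m := fun A => by
      by_cases hA : IsAtomSigmaFinite μ A
      · obtain ⟨W, -, hW⟩ := hex A hA
        exact ⟨_, fun _ => hW⟩
      · exact ⟨0, fun h => absurd h hA⟩
    choose m hm using this
    exact ⟨m, hm⟩
  have hformula : ∀ m : Set Ω → Ω → EReal,
      (∀ A, IsAtomSigmaFinite μ A → IsSepEssInfOn μ f A (m A)) →
      (⨅ u ∈ R, integralFunctional μ f u) = exhaustingIntegralFamily μ m := fun m hm =>
    le_antisymm (iInf_integralFunctional_le hR hRdec hf hatom hu₀ hu₀fin hex hm)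
      (le_iInf_integralFunctional hR hm)
  refine ⟨hexm, hformula, fun hbot => ?_⟩
  have htop : (⨅ u ∈ R, integralFunctional μ f u) ≠ ⊤ :=
    ne_top_of_le_ne_top hu₀fin (iInf₂_le u₀ hu₀)
  obtain ⟨m, hm⟩ := hexm
  obtain ⟨S, m₀, hS, hm₀m, hm₀, hm₀0, hu₀S⟩ := exists_measurable_isSepEssInfOn hf hu₀m hu₀fin hex hm
    (hformula m hm ▸ hbot) (hformula m hm ▸ htop)
  have hglob := isSepEssInf_of_forall_isSepEssInfOn hm₀m.aemeasurable hm₀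
  refine ⟨⟨m₀, hglob⟩, fun m' hm' => ?_⟩
  have hae : ∀ᵐ ω ∂μ, m₀ ω = m' ω := hglob.ae_eq hm'
  have hloc : ∀ A, IsAtomSigmaFinite μ A → IsSepEssInfOn μ f A m' := fun A hA =>
    (hm₀ A hA).congr (ae_restrict_of_ae hae)
  have hval : (⨅ u ∈ R, integralFunctional μ f u) = exhaustingIntegral μ m' :=
    hformula (fun _ => m') hloc
  have hattain : ∀ A, IsAtomSigmaFinite μ A → ∃ W : Set M, TopologicalSpace.IsSeparable W ∧
      ∀ᵐ ω ∂(μ.restrict A), (⨅ x ∈ W, f ω x) = m' ω := fun A hA =>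
    (hloc A hA).exists_iInf_eq (hex A hA)
  have hmin : ∀ v ∈ R, IsMinOn (integralFunctional μ f) R v ↔
      IntegrallyAE μ (fun ω => f ω (v ω) = m' ω) := by
    intro v hv
    constructor
    · intro hvmin
      have hle : integralFunctional μ f v ≤ exhaustingIntegral μ m' := by
        rw [← hval]
        exact le_iInf₂ fun u hu => isMinOn_iff.1 hvmin u hu
      exact integrallyAE_eq_of_exhaustingIntegral_le (fun A hA => (hloc A hA).1)
        (fun A hA => hf.aemeasurable_comp (hR v hv) hA)
        (fun A hA => (hloc A hA).ae_le_comp hA (hR v hv)) (hval ▸ hbot) (hval ▸ htop) hle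
    · intro hvm
      refine isMinOn_iff.2 fun u hu => ?_
      calc integralFunctional μ f v ≤ exhaustingIntegral μ m' :=
            exhaustingIntegralFamily_mono fun A hA => (hvm A hA).mono fun ω hω => hω.le
        _ = ⨅ u ∈ R, integralFunctional μ f u := hval.symm
        _ ≤ integralFunctional μ f u := iInf₂_le u hu
  refine ⟨hval, hattain, fun hsep => ?_, hmin, fun v hv hvm => (hmin v hv).trans ?_⟩
  · obtain ⟨W, hW, hWm⟩ := hattain S hS.isAtomSigmaFinite
    have hV := hW.union (hsep u₀ hu₀)
    refine ⟨W ∪ range u₀, hV, fun A hA => ?_⟩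
    have hres : μ.restrict A = μ.restrict ((A ∩ S) ∪ (A \ S)) := by rw [inter_union_sdiff]
    have hge := (hloc A hA).2.1 _ hV
    rw [hres, ae_restrict_union_iff] at hge ⊢
    constructor
    · filter_upwards [hge.1, ae_restrict_of_ae_restrict_of_subset inter_subset_right hWm]
        with ω h1 h2
      exact le_antisymm (h2 ▸ biInf_mono subset_union_left) h1
    -- off `S` the essential infimum function is `0`, and `f ω (u₀ ω) ≤ 0`
    · filter_upwards [hge.2, hu₀S A hA, ae_restrict_of_ae hae,
        ae_restrict_mem (hA.measurableSet.diff hS.measurableSet)] with ω h1 h2 h3 h4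
      refine le_antisymm ?_ h1
      rw [← h3, hm₀0 ω h4.2]
      exact (iInf₂_le _ (.inr (mem_range_self ω))).trans h2
  · refine integrallyAE_iff_ae μ _ ?_
    have h1 := nullMeasurableSet_le hvm hm'.1
    have h2 := nullMeasurableSet_le hm'.1 hvm
    convert (h1.inter h2).compl using 1
    ext ω
    simp only [mem_ofPred_eq, mem_compl_iff, mem_inter_iff, ← le_antisymm_iff]
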